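/- **Setting.** Let $S$ be a compact connected Riemann surface, $\omega$ an Abelian differential (holomorphic 1-form) on $S$, and $\Sigma$ its set of zeros (conical points). For a tangent vector $v$ at $x\notin\Sigma$, call $\omega_x(v)\in\mathbb C$ its flat coordinate and $|\omega_x(v)|$ its flat norm; let $e_v,e_h$ be the parallel unit vector fields on $S\smallsetminus\Sigma$ with flat coordinates $1$ and $i$, and let $\langle\cdot,\cdot\rangle$ be the flat inner product. Let $\varphi:S\to S$ be a linear pseudo-Anosov homeomorphism with stretch factor $\lambda>1$: $\varphi(\Sigma)=\Sigma$, and on $S\smallsetminus\Sigma$ the map $\varphi$ is differentiable with $\mathrm d\varphi\, e_v=\lambda e_v$ and $\mathrm d\varphi\, e_h=\lambda^{-1}e_h$. For each $\sigma\in\Sigma$ fix a holomorphic chart $z$ on a neighbourhood $V_\sigma$, centred at $\sigma$, in which $\omega=z^{n_\sigma-1}\,\mathrm dz$ with $n_\sigma\ge 1$ an integer; put $\xi=z^{n_\sigma}$. The $V_\sigma$ are pairwise disjoint, and $\alpha_\sigma>0$ is such that $z(V_\sigma)$ contains the closed disc $\{|z|^{n_\sigma}\le\alpha_\sigma\}$.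 Assume that $\varphi$ fixes each $\sigma\in\Sigma$ and preserves the sheets of the branched cover $\xi$ near $\sigma$ (near $\sigma$ it is the sheet-preserving lift through $\xi$ of $x+iy\mapsto\lambda x+i\lambda^{-1}y$). Let $k_\sigma:\mathbb R\to\mathbb R$ be even, of class $C^1$, supported in $[-1,1]$, non-increasing on $[0,\infty)$, with $k_\sigma(0)=1$ and $k_\sigma'$ Lipschitz. For $\beta=(\beta_\sigma)_{\sigma\in\Sigma}$ with all $\beta_\sigma\in(-\lambda+\lambda^{-2},0]$, let $f_\beta:S\to S$ be the map equal to $\varphi$ outside the discs $\{|\xi|\le\alpha_\sigma\}$ and given on each of them by the sheet-preserving lift through $\xi$ of $$x+iy\ \mapsto\ \bigl(\lambda+\beta_\sigma k_\sigma(|x+iy|/\alpha_\sigma)\bigr)x+i\lambda^{-1}y ;$$ that is, by $\varphi$ composed with the sheet-preserving lift of $x+iy\mapsto(1+\lambda^{-1}\beta_\sigma k_\sigma(|x+iy|/\alpha_\sigma))x+iy$, a map from the disc to itself. With $a_\beta=\langle\mathrm df_\beta\, e_v,e_v\rangle$ and $b_\beta=\langle \mathrm df_\beta\, e_h,e_v\rangle$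 on $S\smallsetminus\Sigma$, define $$v^s_\beta(x)=e_h-\Bigl(\sum_{i\ge0}\lambda^{-i}\,b_\beta(f_\beta^i(x))\prod_{j=0}^{i}\frac1{a_\beta(f_\beta^j(x))}\Bigr)e_v,\qquad x\in S\smallsetminus\Sigma .$$ **Theorem.** For every $\beta\in(-\lambda+\lambda^{-2},0]^{\Sigma}$ the field $v^s_\beta$ is well defined on $S\smallsetminus\Sigma$ ($f_\beta$ maps $S\smallsetminus\Sigma$ to itself and is differentiable there, $a_\beta>0$, and the series converges), and it is bounded and continuous. The map $\beta\mapsto v^s_\beta$ is continuous on $(-\lambda+\lambda^{-2},0]^{\Sigma}$ for the sup norm (of the flat norm). Consequently $(x,\beta)\mapsto v^s_\beta(x)$ is jointly continuous on $(S\smallsetminus\Sigma)\times(-\lambda+\lambda^{-2},0]^{\Sigma}$. In particular, if $\Sigma$ is a single point, $\beta$ ranges over the interval $(-\lambda+\lambda^{-2},0]$. -/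

import Mathlib

open Set Filter Topology
open scoped Manifold ContDiff BoundedContinuousFunction

noncomputable section

namespace PertPA

variable {S : Type*} [TopologicalSpace S] [ChartedSpace ℂ S]

/-- An Abelian differential (holomorphic 1-form) on a Riemann surface `S`: a complex-linear
functional on every tangent space whose coefficient in each chart `z` (the `g` such that the form
reads `g(z) dz`) is holomorphic. -/
structure AbelianDifferential (S : Type*) [TopologicalSpace S] [ChartedSpace ℂ S] where
  form : (x : S) → TangentSpace 𝓘(ℂ) x →L[ℂ] ℂ
  holomorphic : ∀ x₀ : S, DifferentiableOn ℂ
    (fun z : ℂ => form ((chartAt ℂ x₀).symm z)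
      (mfderiv 𝓘(ℂ) 𝓘(ℂ) (chartAt ℂ x₀).symm z (1 : ℂ)))
    (chartAt ℂ x₀).target

/-- The conical points: the zeros of the Abelian differential. -/
def AbelianDifferential.zeros (η : AbelianDifferential S) : Set S := {x | η.form x = 0}

/-- The flat coordinate `η_x(v)` of a (real) tangent vector `v` at `x`. The real tangent space is
the complex one with scalars restricted. The flat length of `v` is `‖η.coord x v‖`. -/
def AbelianDifferential.coord (η : AbelianDifferential S) (x : S) (v : TangentSpace 𝓘(ℝ, ℂ) x) :
    ℂ :=
  η.form x v

/-- The tangent vector at `x` with flat coordinate `w`, for `x` outside the zeros. -/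
def AbelianDifferential.vec (η : AbelianDifferential S) (x : S) (w : ℂ) :
    TangentSpace 𝓘(ℝ, ℂ) x :=
  (w / η.form x (1 : ℂ) : ℂ)

/-- The parallel unit field `e_v` with flat coordinate `1` (direction stretched by the
pseudo-Anosov map). -/
def AbelianDifferential.eV (η : AbelianDifferential S) (x : S) : TangentSpace 𝓘(ℝ, ℂ) x :=
  η.vec x 1

/-- The parallel unit field `e_h` with flat coordinate `i` (direction contracted by the
pseudo-Anosov map). -/
def AbelianDifferential.eH (η : AbelianDifferential S) (x : S) : TangentSpace 𝓘(ℝ, ℂ) x :=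
  η.vec x Complex.I

theorem AbelianDifferential.coord_vec (η : AbelianDifferential S) {x : S} (hx : x ∉ η.zeros)
    (w : ℂ) : η.coord x (η.vec x w) = w := by
  have key : ∀ L : ℂ →L[ℂ] ℂ, L ≠ 0 → L (w / L 1) = w := by
    intro L hL
    have h1 : L 1 ≠ 0 := by
      intro h
      apply hL
      ext
      simpa using h
    have h2 : L (w / L 1) = (w / L 1) * L 1 := by
      have := L.map_smul (w / L 1) 1
      simpa using this
    rw [h2, div_mul_cancel₀ _ h1]
  exact key (η.form x) hx

/-- A cone chart at `σ`: a holomorphic chart `z`, centred at `σ`, with `η = z ^ (n - 1) dz`. -/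
structure ConeChart (η : AbelianDifferential S) (σ : S) where
  chart : OpenPartialHomeomorph S ℂ
  mem_maximalAtlas : chart ∈ IsManifold.maximalAtlas 𝓘(ℂ) ω S
  mem_source : σ ∈ chart.source
  map_center : chart σ = 0
  n : ℕ
  n_pos : 0 < n
  form_eq : ∀ x ∈ chart.source, ∀ v : TangentSpace 𝓘(ℂ) x,
    let w : ℂ := mfderiv 𝓘(ℂ) 𝓘(ℂ) chart x v
    η.form x v = chart x ^ (n - 1) * w

/-- The linear map `x + iy ↦ l x + i l⁻¹ y`. -/
def diagMap (l : ℝ) (w : ℂ) : ℂ := ⟨l * w.re, l⁻¹ * w.im⟩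

/-- The perturbed linear map `x + iy ↦ (l + b k(|x + iy| / r)) x + i l⁻¹ y`. -/
def modelMap (l b r : ℝ) (k : ℝ → ℝ) (w : ℂ) : ℂ :=
  ⟨(l + b * k (‖w‖ / r)) * w.re, l⁻¹ * w.im⟩

/-- The lift of `T` through the branched cover `z ↦ z ^ n`, preserving its sheets, for maps `T`
that map the open upper and lower half-planes and the two open real half-lines each into itself:
the `n`-th root of `T (z ^ n)` that lies in the same sector of `{z | Im (z ^ n) ≠ 0}` as `z`
(or on the same ray). The quotient below avoids the negative real axis, where the principal root
is discontinuous. -/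
def sheetLift (n : ℕ) (T : ℂ → ℂ) (z : ℂ) : ℂ := z * (T (z ^ n) / z ^ n) ^ ((n : ℂ)⁻¹)

/-- Composing the lift of `(diagMap l)⁻¹ ∘ modelMap` with that of `diagMap l` gives the lift of
`modelMap`. -/
theorem sheetLift_diagMap_comp {n : ℕ} (hn : 0 < n) {l b r : ℝ} {k : ℝ → ℝ} (hl : 0 < l) (z : ℂ)
    (hp : 0 < l + b * k (‖z ^ n‖ / r)) :
    sheetLift n (diagMap l) (sheetLift n (fun w => diagMap l⁻¹ (modelMap l b r k w)) z) =
      sheetLift n (modelMap l b r k) z := by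
  rcases eq_or_ne z 0 with rfl | hz
  · simp [sheetLift]
  have hre : ∀ u w : ℂ, 0 < u.re * w.re + u.im * w.im → u / w ≠ 0 ∧ 0 < (u / w).re := by
    intro u w h
    have hw : w ≠ 0 := by rintro rfl; simp at h
    have h2 : 0 < (u / w).re := by
      rw [Complex.div_re, ← add_div]
      exact div_pos h (Complex.normSq_pos.2 hw)
    exact ⟨fun h0 => by simp [h0] at h2, h2⟩
  set ξ := z ^ n with hξ
  have hξ0 : ξ ≠ 0 := pow_ne_zero _ hz
  set u := diagMap l⁻¹ (modelMap l b r k ξ) with hu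
  set t := modelMap l b r k ξ with ht
  have hxy : 0 < ξ.re ^ 2 ∨ 0 < ξ.im ^ 2 := by
    by_contra h
    have h0 : ξ.re = 0 ∧ ξ.im = 0 := by
      constructor
      · by_contra h1
        exact h (Or.inl (by positivity))
      · by_contra h1
        exact h (Or.inr (by positivity))
    exact hξ0 (Complex.ext h0.1 h0.2)
  have hcomb : ∀ c d : ℝ, 0 < c → 0 < d → 0 < c * ξ.re ^ 2 + d * ξ.im ^ 2 := by
    intro c d hc hd
    rcases hxy with h | h <;> positivity
  have h1 : u / ξ ≠ 0 ∧ 0 < (u / ξ).re := by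
    apply hre
    have := hcomb (l⁻¹ * (l + b * k (‖ξ‖ / r))) 1 (by positivity) one_pos
    simp only [hu, ht, diagMap, modelMap]
    convert this using 1
    field_simp
  have h2 : t / u ≠ 0 ∧ 0 < (t / u).re := by
    apply hre
    have := hcomb (l⁻¹ * (l + b * k (‖ξ‖ / r)) ^ 2) l⁻¹ (by positivity) (by positivity)
    simp only [hu, ht, diagMap, modelMap]
    convert this using 1
    field_simp
  have hu0 : u ≠ 0 := fun h => h1.1 (by simp [h])
  have hdu : diagMap l u = t := by
    apply Complex.ext <;> simp only [hu, diagMap] <;> field_simp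
  have hpow : (z * (u / ξ) ^ ((n : ℂ)⁻¹)) ^ n = u := by
    rw [mul_pow, ← Complex.cpow_nat_mul, mul_inv_cancel₀ (by exact_mod_cast hn.ne'),
      Complex.cpow_one, ← hξ, mul_div_cancel₀ _ hξ0]
  have ha1 := Complex.abs_arg_lt_pi_div_two_iff.2 (Or.inl h1.2)
  have ha2 := Complex.abs_arg_lt_pi_div_two_iff.2 (Or.inl h2.2)
  rw [abs_lt] at ha1 ha2
  have hlog : Complex.log (u / ξ * (t / u)) = Complex.log (u / ξ) + Complex.log (t / u) :=
    Complex.log_mul (x := u / ξ) (y := t / u) h1.1 h2.1 ⟨by linarith, by linarith⟩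
  have hq : u / ξ * (t / u) = t / ξ := by field_simp
  simp only [sheetLift, ← hξ, ← hu, ← ht]
  rw [hpow, hdu, mul_assoc, ← hq, Complex.cpow_def_of_ne_zero h1.1,
    Complex.cpow_def_of_ne_zero h2.1, Complex.cpow_def_of_ne_zero (mul_ne_zero h1.1 h2.1), hlog,
    ← Complex.exp_add, add_mul]

/-- `φ` is a linear pseudo-Anosov map of the flat surface with stretch factor `l`:
it is given by `x + iy ↦ l x + i l⁻¹ y` in flat coordinates. -/
def IsLinearPseudoAnosov (η : AbelianDifferential S) (l : ℝ) (φ : S ≃ₜ S) : Prop :=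
  1 < l ∧ φ '' η.zeros = η.zeros ∧
    ∀ x ∉ η.zeros, MDifferentiableAt 𝓘(ℝ, ℂ) 𝓘(ℝ, ℂ) φ x ∧
      ∀ v : TangentSpace 𝓘(ℝ, ℂ) x,
        η.coord (φ x) (mfderiv 𝓘(ℝ, ℂ) 𝓘(ℝ, ℂ) φ x v) = diagMap l (η.coord x v)

/-- `φ` fixes every conical point and respects the sheets of the branched covers: near each conical
point, it is the sheet-preserving lift of `x + iy ↦ l x + i l⁻¹ y`. -/
def RespectsSheets (η : AbelianDifferential S) (e : ∀ σ : η.zeros, ConeChart η σ.1) (l : ℝ)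
    (φ : S ≃ₜ S) : Prop :=
  ∀ σ : η.zeros, φ σ.1 = σ.1 ∧
    ∀ᶠ x in 𝓝 σ.1, (e σ).chart (φ x) = sheetLift (e σ).n (diagMap l) ((e σ).chart x)

/-- The profiles `k`: even unimodal `C¹` functions supported in `[-1, 1]`, with Lipschitz derivative
and normalised by `k 0 = 1`. -/
structure IsProfile (k : ℝ → ℝ) : Prop where
  contDiff : ContDiff ℝ 1 k
  even : ∀ t, k (-t) = k t
  antitoneOn : AntitoneOn k (Ici 0)
  support : tsupport k ⊆ Icc (-1) 1
  lipschitz : ∃ C, LipschitzWith C (deriv k)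
  at_zero : k 0 = 1

open Classical in
/-- The perturbed map `f_β`. It is `φ` off the discs `|z ^ n| ≤ α σ`. On such a disc it is the lift
of `modelMap`, written as `φ` (the lift of `diagMap l`) composed with the lift of
`(diagMap l)⁻¹ ∘ modelMap`: the latter maps the disc to itself, so this makes sense even if the
image of the disc sticks out of the domain of the cone chart. -/
def pertMap (η : AbelianDifferential S) (e : ∀ σ : η.zeros, ConeChart η σ.1) (l : ℝ)
    (φ : S ≃ₜ S) (k : η.zeros → ℝ → ℝ) (α β : η.zeros → ℝ) (x : S) : S :=
  if h : ∃ σ : η.zeros, x ∈ (e σ).chart.source ∧ ‖(e σ).chart x ^ (e σ).n‖ ≤ α σ then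
    φ ((e h.choose).chart.symm (sheetLift (e h.choose).n
      (fun w => diagMap l⁻¹ (modelMap l (β h.choose) (α h.choose) (k h.choose) w))
      ((e h.choose).chart x)))
  else φ x

/-- The coefficient `a(x) = ⟨d_x f e_v, e_v⟩`. -/
def coefA (η : AbelianDifferential S) (f : S → S) (x : S) : ℝ :=
  (η.coord (f x) (mfderiv 𝓘(ℝ, ℂ) 𝓘(ℝ, ℂ) f x (η.eV x))).re

/-- The coefficient `b(x) = ⟨d_x f e_h, e_v⟩`. -/
def coefB (η : AbelianDifferential S) (f : S → S) (x : S) : ℝ :=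
  (η.coord (f x) (mfderiv 𝓘(ℝ, ℂ) 𝓘(ℝ, ℂ) f x (η.eH x))).re

/-- The terms `λ^{-i} b(f^i x) ∏_{j ≤ i} 1 / a(f^j x)` of the series defining `v^s`. -/
def stableTerm (η : AbelianDifferential S) (l : ℝ) (f : S → S) (x : S) (i : ℕ) : ℝ :=
  (l ^ i)⁻¹ * coefB η f (f^[i] x) * ∏ j ∈ Finset.range (i + 1), (coefA η f (f^[j] x))⁻¹

/-- The stable vector field `v^s = e_h - (∑ i, λ^{-i} b(f^i) ∏_{j ≤ i} 1 / a(f^j)) e_v`. -/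
def stableField (η : AbelianDifferential S) (l : ℝ) (f : S → S) (x : S) :
    TangentSpace 𝓘(ℝ, ℂ) x :=
  η.eH x - (∑' i, stableTerm η l f x i) • η.eV x

/-- The parameters `β` all of whose components lie in `(-λ + λ^{-2}, 0]`. -/
def paramRange (η : AbelianDifferential S) (l : ℝ) : Set (η.zeros → ℝ) :=
  {β | ∀ σ, β σ ∈ Ioc (-l + (l ^ 2)⁻¹) 0}

end PertPA

end

/-! Off the discs `a = l` and `b = 0`. Each term of the series is `l⁻¹ a(x)⁻¹` times the
previous-index term at `f x`, so the difficulty is a passage through a disc: for `β` close to `-l +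
l⁻²` the factor `l⁻¹ a⁻¹` exceeds `1` near the conical point.

Two effects compensate. Write `w = ξ` for the coordinate in a disc of radius `r`; one step
multiplies `Re w` by `g = l + β k` and `Im w` by `l⁻¹`. Since `β ≤ 0` and `k' ≤ 0`, `g ≤ a`. If the
orbit leaves the disc, `Re w` had to be stretched across the chord at its height, so the product of
the `g⁻¹` over the stay is at most `1`, and a stay of `m` steps costs at most `l⁻ᵐ`. If the orbit is
still in the disc when `b` is evaluated, then `b = O(|Im w| / r)`, because `k'` is Lipschitz and
vanishes at `0`; `Im w` shrinks by `l⁻¹` per step, and the cost per step is `l⁻² / a`, less than `1`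
as `a > l⁻²`. A single induction handles both cases, with the weight `max t (|Im w| / r)`, where `t`
bounds `|Re w|` relative to the half-chord (`abs_seriesTerm_le`). The resulting ratio `max l⁻¹ (l⁻²
/ a₀)` is locally uniform in `β`.

To follow an orbit in the coordinate `w`, `φ` must be the expected lift on the whole part of the
disc that it returns to the disc, whereas this is assumed only near `σ`; it propagates along radii
(`ConeChart.apply_symm_eq`).

Finally `a` and `b` extend continuously over the conical points, so the sum is jointly continuous on
parameters times the compact surface, and currying turns this into continuity for the sup norm. -/

noncomputable section

namespace PertPA

/-! ### Profiles, the model map and its lifts in the plane -/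

section

namespace IsProfile

variable {k : ℝ → ℝ} (hk : IsProfile k)
include hk

theorem continuous_deriv : Continuous (deriv k) := hk.contDiff.continuous_deriv le_rfl

theorem hasDerivAt (t : ℝ) : HasDerivAt k (deriv k t) t :=
  (hk.contDiff.differentiable one_ne_zero t).hasDerivAt

theorem eq_zero_of_one_le {t : ℝ} (ht : 1 ≤ t) : k t = 0 := by
  have h : EqOn k 0 (Ioi 1) := fun s hs => image_eq_zero_of_notMem_tsupport
    fun h => absurd (hk.support h).2 (not_le.2 hs)
  have := h.closure hk.contDiff.continuous continuous_const
  rw [closure_Ioi] at this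
  exact this ht

theorem deriv_eq_zero_of_one_le {t : ℝ} (ht : 1 ≤ t) : deriv k t = 0 := by
  have h : EqOn (deriv k) 0 (Ioi 1) := fun s hs => by
    have : k =ᶠ[𝓝 s] fun _ => 0 := by
      filter_upwards [lt_mem_nhds hs] with u hu using hk.eq_zero_of_one_le hu.le
    rw [this.deriv_eq]; simp
  have := h.closure hk.continuous_deriv continuous_const
  rw [closure_Ioi] at this
  exact this ht

theorem le_one {t : ℝ} (ht : 0 ≤ t) : k t ≤ 1 :=
  hk.at_zero ▸ hk.antitoneOn (mem_Ici.2 le_rfl) ht ht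

theorem nonneg {t : ℝ} (ht : 0 ≤ t) : 0 ≤ k t := by
  rw [← hk.eq_zero_of_one_le (le_max_right t 1)]
  exact hk.antitoneOn ht (ht.trans (le_max_left _ _)) (le_max_left _ _)

theorem deriv_zero : deriv k 0 = 0 := by
  have h1 := hk.hasDerivAt 0
  have h2 : HasDerivAt k (-deriv k 0) 0 := by
    have h3 : HasDerivAt (fun t => k (-t)) (-deriv k 0) 0 := by
      have h4 : HasDerivAt k (deriv k 0) (-0) := by simpa using h1
      have h5 := h4.scomp (0 : ℝ) (hasDerivAt_neg (0 : ℝ))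
      rw [neg_one_smul] at h5
      exact h5
    simpa only [hk.even] using h3
  linarith [h1.unique h2]

theorem deriv_nonpos {t : ℝ} (ht : 0 ≤ t) : deriv k t ≤ 0 := by
  rcases ht.eq_or_lt with rfl | ht
  · exact hk.deriv_zero.le
  · rw [← derivWithin_of_mem_nhds (Ici_mem_nhds ht)]
    exact hk.antitoneOn.derivWithin_nonpos

/-- The Lipschitz condition at `0`, where evenness forces `deriv k 0 = 0`. This linear vanishing
cancels the `1 / ‖w‖` in `modelB`. -/
theorem exists_abs_deriv_le : ∃ C : ℝ, 0 ≤ C ∧ ∀ t, |deriv k t| ≤ C * |t| := by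
  obtain ⟨C, hC⟩ := hk.lipschitz
  refine ⟨C, C.2, fun t => ?_⟩
  simpa [hk.deriv_zero] using hC.dist_le_mul t 0

end IsProfile

/-- The `x`-component of the derivative of `modelMap l b r k` along `1`. -/
def modelA (l b r : ℝ) (k : ℝ → ℝ) (w : ℂ) : ℝ :=
  l + b * (k (‖w‖ / r) + deriv k (‖w‖ / r) * (w.re ^ 2 / (‖w‖ * r)))

/-- The `x`-component of the derivative of `modelMap l b r k` along `i`. -/
def modelB (b r : ℝ) (k : ℝ → ℝ) (w : ℂ) : ℝ :=
  b * (deriv k (‖w‖ / r) * (w.re * w.im / (‖w‖ * r)))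

theorem hasFDerivAt_norm_complex {w : ℂ} (hw : w ≠ 0) :
    HasFDerivAt (fun w : ℂ => ‖w‖)
      ((w.re / ‖w‖) • Complex.reCLM + (w.im / ‖w‖) • Complex.imCLM) w := by
  have h1 : HasFDerivAt (fun w : ℂ => w.re ^ 2 + w.im ^ 2)
      ((2 * w.re) • Complex.reCLM + (2 * w.im) • Complex.imCLM) w := by
    exact (((Complex.reCLM.hasFDerivAt (x := w)).pow 2).add
      ((Complex.imCLM.hasFDerivAt (x := w)).pow 2)).congr_fderiv (by ext1; simp)
  have h2 : w.re ^ 2 + w.im ^ 2 ≠ 0 := by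
    have := Complex.normSq_pos.2 hw
    rw [Complex.normSq_apply] at this
    nlinarith
  have h3 := h1.sqrt h2
  have h4 : (fun w : ℂ => ‖w‖) = fun w : ℂ => √(w.re ^ 2 + w.im ^ 2) := by
    ext w
    rw [Complex.norm_eq_sqrt_sq_add_sq]
  rw [h4]
  refine h3.congr_fderiv ?_
  have : √(w.re ^ 2 + w.im ^ 2) ≠ 0 := by
    rw [← Complex.norm_eq_sqrt_sq_add_sq]; exact norm_ne_zero_iff.2 hw
  ext1; simp [Complex.norm_eq_sqrt_sq_add_sq]; field_simp

theorem hasFDerivAt_modelMap {l b r : ℝ} {k : ℝ → ℝ} (hk : IsProfile k) {w : ℂ} (hw : w ≠ 0) :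
    ∃ D : ℂ →L[ℝ] ℂ, HasFDerivAt (modelMap l b r k) D w ∧
      (D 1).re = modelA l b r k w ∧ (D Complex.I).re = modelB b r k w := by
  have h1 : HasFDerivAt (fun w : ℂ => k (‖w‖ / r)) _ w :=
    (hk.hasDerivAt (‖w‖ / r)).comp_hasFDerivAt w ((hasFDerivAt_norm_complex hw).mul_const r⁻¹)
  have h2 := ((h1.const_mul b).const_add l).mul (Complex.reCLM.hasFDerivAt (x := w))
  have h3 := (Complex.imCLM.hasFDerivAt (x := w)).const_mul l⁻¹
  have h4 := Complex.equivRealProdCLM.symm.hasFDerivAt (x := ((l + b * k (‖w‖ / r)) * w.re, l⁻¹ * w.im)) |>.comp w (h2.prodMk h3)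
  refine ⟨_, h4, ?_, ?_⟩
  · simp [modelA]
    field_simp
    ring
  · simp [modelB]
    field_simp

theorem abs_re_mul_div_le {r : ℝ} (hr : 0 < r) (w : ℂ) {u : ℝ} (hu : |u| ≤ ‖w‖) :
    |w.re * u / (‖w‖ * r)| ≤ ‖w‖ / r := by
  rcases eq_or_ne w 0 with rfl | hw
  · simp
  have hw' : 0 < ‖w‖ := norm_pos_iff.2 hw
  rw [abs_div, abs_mul, abs_of_pos (mul_pos hw' hr), div_le_div_iff₀ (mul_pos hw' hr) hr]
  have := mul_le_mul (Complex.abs_re_le_norm w) hu (abs_nonneg _) hw'.le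
  nlinarith

/-- Only `w = 0` is at stake: the quotient is at most `‖w‖ / r` in absolute value, so it tends to
`0`, which is also its value there by the convention on division by zero. Hence `modelA` and
`modelB` are continuous across the conical point. -/
theorem continuous_deriv_mul_quot {r : ℝ} (hr : 0 < r) {k : ℝ → ℝ} (hk : IsProfile k) {u : ℂ → ℝ}
    (hu : Continuous u) (hu' : ∀ w, |u w| ≤ ‖w‖) :
    Continuous fun w : ℂ => deriv k (‖w‖ / r) * (w.re * u w / (‖w‖ * r)) := by
  refine (hk.continuous_deriv.comp (by fun_prop)).mul (continuous_iff_continuousAt.2 fun w => ?_)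
  rcases eq_or_ne w 0 with rfl | hw
  · have h : Tendsto (fun w : ℂ => ‖w‖ / r) (𝓝 0) (𝓝 0) := by
      have : Continuous fun w : ℂ => ‖w‖ / r := by fun_prop
      simpa using this.tendsto 0
    simpa [ContinuousAt] using
      squeeze_zero_norm (fun w => abs_re_mul_div_le hr w (hu' w)) h
  · have : ‖w‖ * r ≠ 0 := mul_ne_zero (norm_ne_zero_iff.2 hw) hr.ne'
    exact ContinuousAt.div (by fun_prop) (by fun_prop) this

theorem continuous_modelA (l : ℝ) {r : ℝ} (hr : 0 < r) {k : ℝ → ℝ} (hk : IsProfile k) :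
    Continuous fun p : ℝ × ℂ => modelA l p.1 r k p.2 := by
  have h1 := continuous_deriv_mul_quot hr hk Complex.continuous_re Complex.abs_re_le_norm
  have h2 := hk.contDiff.continuous
  simp only [← sq] at h1
  unfold modelA
  exact continuous_const.add (continuous_fst.mul
    ((h2.comp (by fun_prop)).add (h1.comp continuous_snd)))

theorem continuous_modelB {r : ℝ} (hr : 0 < r) {k : ℝ → ℝ} (hk : IsProfile k) :
    Continuous fun p : ℝ × ℂ => modelB p.1 r k p.2 :=
  continuous_fst.mul ((continuous_deriv_mul_quot hr hk Complex.continuous_im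
    Complex.abs_im_le_norm).comp continuous_snd)

/-- The extra term in `modelA` is a product of `b ≤ 0`, `k' ≤ 0` and a nonnegative quotient. Thus
the derivative expands at least as much as the map multiplies `Re w`, which lets the displacement of
an orbit control the product of the coefficients. -/
theorem le_modelA {l b r : ℝ} (hr : 0 < r) (hb : b ≤ 0) {k : ℝ → ℝ} (hk : IsProfile k) (w : ℂ) :
    l + b * k (‖w‖ / r) ≤ modelA l b r k w := by
  have h1 := hk.deriv_nonpos (t := ‖w‖ / r) (by positivity)
  have h2 : 0 ≤ w.re ^ 2 / (‖w‖ * r) := by positivity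
  have := mul_nonneg_of_nonpos_of_nonpos hb (mul_nonpos_of_nonpos_of_nonneg h1 h2)
  unfold modelA
  linarith

theorem add_le_gain {l b r : ℝ} (hr : 0 < r) (hb : b ≤ 0) {k : ℝ → ℝ} (hk : IsProfile k)
    (w : ℂ) : l + b ≤ l + b * k (‖w‖ / r) := by
  have := hk.le_one (t := ‖w‖ / r) (by positivity)
  nlinarith

/-- With `|k'(t)| ≤ C |t|` the factors `‖w‖` cancel, leaving a multiple of `|Re w| |Im w| / r²`; the
bound keeps `Im w`, the coordinate contracted along orbits. -/
theorem abs_modelB_le {l b r C : ℝ} (hr : 0 < r) (hb : |b| ≤ l) {k : ℝ → ℝ} (hC : 0 ≤ C)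
    (hk : ∀ t, |deriv k t| ≤ C * |t|) {w : ℂ} (hw : ‖w‖ ≤ r) :
    |modelB b r k w| ≤ l * C * (|w.im| / r) := by
  rcases eq_or_ne w 0 with rfl | hw0
  · simp [modelB]
  have hw' : 0 < ‖w‖ := norm_pos_iff.2 hw0
  have h1 := hk (‖w‖ / r)
  rw [abs_of_nonneg (by positivity : 0 ≤ ‖w‖ / r)] at h1
  have h2 : |w.re| / r ≤ 1 := by
    rw [div_le_one hr]; exact (Complex.abs_re_le_norm w).trans hw
  have hl : 0 ≤ l := (abs_nonneg b).trans hb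
  have h3 : |w.re * w.im / (‖w‖ * r)| = |w.re| * |w.im| / (‖w‖ * r) := by
    rw [abs_div, abs_mul, abs_of_pos (mul_pos hw' hr)]
  rw [modelB, abs_mul, abs_mul, h3]
  calc |b| * (|deriv k (‖w‖ / r)| * (|w.re| * |w.im| / (‖w‖ * r)))
      ≤ l * (C * (‖w‖ / r) * (|w.re| * |w.im| / (‖w‖ * r))) := by gcongr
    _ = l * C * (|w.im| / r) * (|w.re| / r) := by field_simp
    _ ≤ l * C * (|w.im| / r) * 1 := by gcongr
    _ = _ := mul_one _

theorem modelA_of_le {l b r : ℝ} (hr : 0 < r) {k : ℝ → ℝ} (hk : IsProfile k) {w : ℂ}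
    (hw : r ≤ ‖w‖) : modelA l b r k w = l := by
  have : 1 ≤ ‖w‖ / r := by rwa [one_le_div hr]
  simp [modelA, hk.eq_zero_of_one_le this, hk.deriv_eq_zero_of_one_le this]

theorem modelB_of_le {b r : ℝ} (hr : 0 < r) {k : ℝ → ℝ} (hk : IsProfile k) {w : ℂ}
    (hw : r ≤ ‖w‖) : modelB b r k w = 0 := by
  have : 1 ≤ ‖w‖ / r := by rwa [one_le_div hr]
  simp [modelB, hk.deriv_eq_zero_of_one_le this]

/-! ### The perturbation `(diagMap l)⁻¹ ∘ modelMap` of the identity -/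

/-- `x + iy ↦ (1 + l⁻¹ b k(|x + iy| / r)) x + iy`. -/
def discMap (l b r : ℝ) (k : ℝ → ℝ) (w : ℂ) : ℂ := diagMap l⁻¹ (modelMap l b r k w)

theorem diagMap_discMap {l b r : ℝ} (hl : l ≠ 0) (k : ℝ → ℝ) (w : ℂ) :
    diagMap l (discMap l b r k w) = modelMap l b r k w := by
  apply Complex.ext <;> simp only [discMap, diagMap] <;> field_simp

theorem discMap_of_le {l b r : ℝ} (hl : l ≠ 0) (hr : 0 < r) {k : ℝ → ℝ} (hk : IsProfile k) {w : ℂ}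
    (hw : r ≤ ‖w‖) : discMap l b r k w = w := by
  have : 1 ≤ ‖w‖ / r := by rwa [one_le_div hr]
  apply Complex.ext <;> simp [discMap, diagMap, modelMap, hk.eq_zero_of_one_le this] <;> field_simp

theorem discMap_zero (l b r : ℝ) (k : ℝ → ℝ) : discMap l b r k 0 = 0 := by
  apply Complex.ext <;> simp [discMap, diagMap, modelMap]

/-- The real-linear map `diagMap l`, bundled. -/
def diagCLM (l : ℝ) : ℂ →L[ℝ] ℂ :=
  (Complex.equivRealProdCLM.symm : ℝ × ℝ →L[ℝ] ℂ).comp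
    ((l • Complex.reCLM).prod (l⁻¹ • Complex.imCLM))

theorem diagCLM_apply (l : ℝ) (w : ℂ) : diagCLM l w = diagMap l w := by
  apply Complex.ext <;> simp [diagCLM, diagMap]

theorem re_div_pos {u w : ℂ} (h : 0 < u.re * w.re + u.im * w.im) : 0 < (u / w).re := by
  have hw : w ≠ 0 := by rintro rfl; simp at h
  rw [Complex.div_re, ← add_div]
  exact div_pos h (Complex.normSq_pos.2 hw)

theorem comb_sq_pos {w : ℂ} (hw : w ≠ 0) {c d : ℝ} (hc : 0 < c) (hd : 0 < d) :
    0 < c * w.re ^ 2 + d * w.im ^ 2 := by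
  by_cases h : w.re = 0
  · have : w.im ≠ 0 := fun h' => hw (Complex.ext h h')
    positivity
  · positivity

/-- Scaling both real coordinates by positive factors turns `w` by less than a right angle. The
quotient in `sheetLift` therefore stays off the branch cut of the root. -/
theorem diagMap_div_re_pos {l : ℝ} (hl : 0 < l) {w : ℂ} (hw : w ≠ 0) : 0 < (diagMap l w / w).re := by
  apply re_div_pos
  convert comb_sq_pos hw hl (inv_pos.2 hl) using 1
  simp only [diagMap]; ring

theorem discMap_div_re_pos {l b r : ℝ} (hl : 0 < l) {k : ℝ → ℝ} {w : ℂ} (hw : w ≠ 0)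
    (hp : 0 < l + b * k (‖w‖ / r)) : 0 < (discMap l b r k w / w).re := by
  apply re_div_pos
  convert comb_sq_pos hw (mul_pos (inv_pos.2 hl) hp) one_pos using 1
  simp only [discMap, diagMap, modelMap]; field_simp

/-- The real part is multiplied by `l⁻¹ g`, which lies in `[0, 1]`, and the imaginary part is
unchanged. So the lift keeps the disc inside the chart, and is continuous at `0`. -/
theorem norm_discMap_le {l b r : ℝ} (hl : 0 < l) (hr : 0 < r) (hb : b ≤ 0) (hlb : 0 < l + b)
    {k : ℝ → ℝ} (hk : IsProfile k) (w : ℂ) : ‖discMap l b r k w‖ ≤ ‖w‖ := by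
  have h1 := add_le_gain (l := l) hr hb hk w
  have h2 := hk.nonneg (t := ‖w‖ / r) (by positivity)
  set g := l + b * k (‖w‖ / r) with hg
  have h3 : g ≤ l := by nlinarith
  have h4 : l⁻¹ * g ≤ 1 := by rw [inv_mul_le_iff₀ hl]; linarith
  have h5 : 0 ≤ l⁻¹ * g := mul_nonneg (inv_pos.2 hl).le (by linarith)
  rw [Complex.norm_eq_sqrt_sq_add_sq, Complex.norm_eq_sqrt_sq_add_sq]
  apply Real.sqrt_le_sqrt
  have h6 : (discMap l b r k w).re = (l⁻¹ * g) * w.re := by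
    simp [discMap, diagMap, modelMap, hg]; ring
  have h7 : (discMap l b r k w).im = w.im := by
    simp [discMap, diagMap, modelMap, hl.ne']
  rw [h6, h7, mul_pow]
  have : (l⁻¹ * g) ^ 2 ≤ 1 := by nlinarith
  nlinarith [sq_nonneg w.re]

theorem continuous_discMap (l r : ℝ) {k : ℝ → ℝ} (hk : IsProfile k) :
    Continuous fun p : ℝ × ℂ => discMap l p.1 r k p.2 := by
  have h2 := hk.contDiff.continuous
  have h : ∀ p : ℝ × ℂ, discMap l p.1 r k p.2 = Complex.equivRealProdCLM.symm
      (l⁻¹ * ((l + p.1 * k (‖p.2‖ / r)) * p.2.re), l⁻¹⁻¹ * (l⁻¹ * p.2.im)) := fun p => by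
    apply Complex.ext <;> simp [discMap, diagMap, modelMap]
  simp only [h]
  have : Continuous fun p : ℝ × ℂ => k (‖p.2‖ / r) := h2.comp (by fun_prop)
  fun_prop

/-! ### Lifts through the branched cover -/

theorem sheetLift_pow {n : ℕ} (hn : 0 < n) {T : ℂ → ℂ} {z : ℂ} (hz : z ≠ 0) :
    sheetLift n T z ^ n = T (z ^ n) := by
  rw [sheetLift, mul_pow, Complex.cpow_nat_inv_pow _ hn.ne', mul_div_cancel₀ _ (pow_ne_zero _ hz)]

theorem sheetLift_zero (n : ℕ) (T : ℂ → ℂ) : sheetLift n T 0 = 0 := by simp [sheetLift]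

theorem sheetLift_pow_of_zero {n : ℕ} (hn : 0 < n) {T : ℂ → ℂ} (hT : T 0 = 0) (z : ℂ) :
    sheetLift n T z ^ n = T (z ^ n) := by
  rcases eq_or_ne z 0 with rfl | hz
  · rw [sheetLift_zero, zero_pow hn.ne', hT]
  · exact sheetLift_pow hn hz

theorem sheetLift_of_eq {n : ℕ} {T : ℂ → ℂ} {z : ℂ} (h : T (z ^ n) = z ^ n) :
    sheetLift n T z = z := by
  rcases eq_or_ne z 0 with rfl | hz
  · exact sheetLift_zero n T
  · rw [sheetLift, h, div_self (pow_ne_zero _ hz), Complex.one_cpow, mul_one]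

theorem norm_sheetLift_le {n : ℕ} (hn : 0 < n) {T : ℂ → ℂ} {z : ℂ}
    (h : ‖T (z ^ n)‖ ≤ ‖z ^ n‖) : ‖sheetLift n T z‖ ≤ ‖z‖ := by
  rcases eq_or_ne z 0 with rfl | hz
  · simp [sheetLift_zero]
  · rw [← pow_le_pow_iff_left₀ (norm_nonneg _) (norm_nonneg _) hn.ne', ← norm_pow,
      sheetLift_pow hn hz, ← norm_pow]
    exact h

theorem sheetLift_ne_zero {n : ℕ} (hn : 0 < n) {T : ℂ → ℂ} {z : ℂ} (hz : z ≠ 0)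
    (h : 0 < (T (z ^ n) / z ^ n).re) : sheetLift n T z ≠ 0 := by
  intro h0
  have := sheetLift_pow hn (T := T) hz
  rw [h0, zero_pow hn.ne'] at this
  simp [← this] at h

theorem differentiableAt_sheetLift {n : ℕ} {T : ℂ → ℂ} {z : ℂ} (hz : z ≠ 0)
    (hT : DifferentiableAt ℝ T (z ^ n)) (h : 0 < (T (z ^ n) / z ^ n).re) :
    DifferentiableAt ℝ (sheetLift n T) z := by
  have h1 : DifferentiableAt ℝ (fun z : ℂ => T (z ^ n)) z :=
    DifferentiableAt.comp (f := fun z : ℂ => z ^ n) z hT (by fun_prop)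
  have h2 : DifferentiableAt ℝ (fun z : ℂ => T (z ^ n) / z ^ n) z :=
    h1.mul (DifferentiableAt.inv (h := fun z : ℂ => z ^ n) (by fun_prop) (pow_ne_zero _ hz))
  have h3 : DifferentiableAt ℂ (fun u : ℂ => u ^ ((n : ℂ)⁻¹)) (T (z ^ n) / z ^ n) :=
    differentiableAt_id.cpow_const (Or.inl h)
  exact differentiableAt_id.mul
    (DifferentiableAt.comp (f := fun z : ℂ => T (z ^ n) / z ^ n) z (h3.restrictScalars ℝ) h2)

theorem continuous_sheetLift {X : Type*} [TopologicalSpace X] {n : ℕ} (hn : 0 < n)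
    {T : X → ℂ → ℂ} (hT : Continuous fun p : X × ℂ => T p.1 p.2)
    (hpos : ∀ b w, w ≠ 0 → 0 < (T b w / w).re) (hnorm : ∀ b w, ‖T b w‖ ≤ ‖w‖) :
    Continuous fun p : X × ℂ => sheetLift n (T p.1) p.2 := by
  refine continuous_iff_continuousAt.2 fun ⟨b, z⟩ => ?_
  rcases eq_or_ne z 0 with rfl | hz
  · have h : Tendsto (fun p : X × ℂ => ‖p.2‖) (𝓝 (b, 0)) (𝓝 0) := by
      have : Continuous fun p : X × ℂ => ‖p.2‖ := by fun_prop
      simpa using this.tendsto (b, 0)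
    simpa [ContinuousAt, sheetLift_zero] using
      squeeze_zero_norm (fun p => norm_sheetLift_le hn (hnorm p.1 (p.2 ^ n))) h
  · have h1 : Continuous fun p : X × ℂ => T p.1 (p.2 ^ n) :=
      hT.comp (continuous_fst.prodMk (continuous_snd.pow n))
    refine continuousAt_snd.mul (ContinuousAt.cpow ?_ continuousAt_const
      (Or.inl (hpos _ _ (pow_ne_zero _ hz))))
    exact h1.continuousAt.div (by fun_prop) (pow_ne_zero _ hz)

/-- Real homogeneity: scaling by `t` multiplies `z ^ n` by the real number `t ^ n`, so the quotient
under the root does not change. The lift thus maps radii to radii. -/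
theorem sheetLift_diagMap_smul (n : ℕ) (l t : ℝ) (z : ℂ) :
    sheetLift n (diagMap l) (t * z) = t * sheetLift n (diagMap l) z := by
  rcases eq_or_ne t 0 with rfl | ht
  · simp [sheetLift_zero]
  have h : diagMap l ((t * z) ^ n) = (t : ℂ) ^ n * diagMap l (z ^ n) := by
    rw [mul_pow, ← Complex.ofReal_pow]
    generalize t ^ n = s
    apply Complex.ext <;> simp [diagMap] <;> ring
  have ht' : (t : ℂ) ^ n ≠ 0 := pow_ne_zero _ (Complex.ofReal_ne_zero.2 ht)
  rw [sheetLift, sheetLift, h, mul_pow, mul_div_mul_left _ _ ht', mul_assoc]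

end

/-! ### Flat coordinates, cone charts and the pseudo-Anosov map near a conical point -/

section

theorem hasMFDerivAt_restrictScalars {M N : Type*} [TopologicalSpace M] [ChartedSpace ℂ M]
    [TopologicalSpace N] [ChartedSpace ℂ N] {f : M → N} {x : M} {L : ℂ →L[ℂ] ℂ}
    (h : HasMFDerivAt 𝓘(ℂ) 𝓘(ℂ) f x L) :
    HasMFDerivAt 𝓘(ℝ, ℂ) 𝓘(ℝ, ℂ) f x (L.restrictScalars ℝ) :=
  ⟨h.1, HasFDerivWithinAt.restrictScalars ℝ h.2⟩

theorem mdifferentiableAt_restrictScalars {M N : Type*} [TopologicalSpace M] [ChartedSpace ℂ M]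
    [TopologicalSpace N] [ChartedSpace ℂ N] {f : M → N} {x : M}
    (h : MDifferentiableAt 𝓘(ℂ) 𝓘(ℂ) f x) : MDifferentiableAt 𝓘(ℝ, ℂ) 𝓘(ℝ, ℂ) f x :=
  (hasMFDerivAt_restrictScalars h.hasMFDerivAt).mdifferentiableAt

variable {S : Type*} [TopologicalSpace S] [ChartedSpace ℂ S]

theorem coord_vec_eq (η : AbelianDifferential S) {x : S} (hx : x ∉ η.zeros) (r : ℝ) :
    η.coord x (η.eH x - r • η.eV x) = Complex.I - r := by
  have h1 : η.coord x (η.eH x) = Complex.I := η.coord_vec hx _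
  have h2 : η.coord x (η.eV x) = 1 := η.coord_vec hx _
  have key : ∀ (L : ℂ →L[ℂ] ℂ) (u v : ℂ), L (u - r • v) = L u - r * L v := by
    intro L u v
    rw [map_sub, Complex.real_smul, ← smul_eq_mul, map_smul, smul_eq_mul]
  have h3 := key (η.form x) (η.eH x) (η.eV x)
  change η.coord x (η.eH x - r • η.eV x) = η.coord x (η.eH x) - r * η.coord x (η.eV x) at h3
  rw [h3, h1, h2, mul_one]

theorem AbelianDifferential.isClosed_zeros [IsManifold 𝓘(ℂ) ω S] (η : AbelianDifferential S) : IsClosed η.zeros := by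
  rw [← isOpen_compl_iff, isOpen_iff_mem_nhds]
  intro x₀ hx₀
  have hmd := mdifferentiable_chart (I := 𝓘(ℂ)) x₀
  have hc := (η.holomorphic x₀).continuousOn
  have hx : x₀ ∈ (chartAt ℂ x₀).source := mem_chart_source ℂ x₀
  have hne : η.form ((chartAt ℂ x₀).symm (chartAt ℂ x₀ x₀))
      (mfderiv 𝓘(ℂ) 𝓘(ℂ) (chartAt ℂ x₀).symm (chartAt ℂ x₀ x₀) (1 : ℂ)) ≠ 0 := by
    intro h0
    obtain ⟨u, hu⟩ : ∃ u : ℂ, mfderiv 𝓘(ℂ) 𝓘(ℂ) (chartAt ℂ x₀).symm (chartAt ℂ x₀ x₀) (1 : ℂ) = u :=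
      ⟨_, rfl⟩
    have hu0 : u ≠ 0 := by
      intro h
      have hinj := hmd.symm.mfderiv_injective (x := chartAt ℂ x₀ x₀)
        ((chartAt ℂ x₀).map_source hx)
      exact one_ne_zero (α := ℂ) (hinj ((hu.trans h).trans (map_zero _).symm))
    rw [hu, (chartAt ℂ x₀).left_inv hx] at h0
    have key : ∀ L : ℂ →L[ℂ] ℂ, L u = 0 → L = 0 := by
      intro L hL
      ext
      have := L.map_smul u⁻¹ u
      rw [hL, smul_eq_mul, inv_mul_cancel₀ hu0] at this
      simpa using this
    exact hx₀ (key (η.form x₀) h0)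
  have h1 : ∀ᶠ x in 𝓝 x₀, η.form ((chartAt ℂ x₀).symm (chartAt ℂ x₀ x))
      (mfderiv 𝓘(ℂ) 𝓘(ℂ) (chartAt ℂ x₀).symm (chartAt ℂ x₀ x) (1 : ℂ)) ≠ 0 := by
    have h2 := (hc.continuousAt ((chartAt ℂ x₀).open_target.mem_nhds
      ((chartAt ℂ x₀).map_source hx))).comp ((chartAt ℂ x₀).continuousAt hx)
    exact h2.eventually_ne hne
  filter_upwards [h1, (chartAt ℂ x₀).open_source.mem_nhds hx] with x hx1 hx2 hx3
  rw [(chartAt ℂ x₀).left_inv hx2] at hx1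
  apply hx1
  have : η.form x = 0 := hx3
  rw [this]
  rfl

namespace ConeChart

variable {η : AbelianDifferential S} {σ : S} (c : ConeChart η σ)

theorem mdifferentiable : c.chart.MDifferentiable 𝓘(ℂ) 𝓘(ℂ) :=
  ⟨(contMDiffOn_of_mem_maximalAtlas c.mem_maximalAtlas).mdifferentiableOn (by simp),
    (contMDiffOn_symm_of_mem_maximalAtlas c.mem_maximalAtlas).mdifferentiableOn (by simp)⟩

theorem mdifferentiable_real : c.chart.MDifferentiable 𝓘(ℝ, ℂ) 𝓘(ℝ, ℂ) :=
  ⟨fun _ hx => (mdifferentiableAt_restrictScalars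
      (c.mdifferentiable.mdifferentiableAt hx)).mdifferentiableWithinAt,
    fun _ hx => (mdifferentiableAt_restrictScalars
      (c.mdifferentiable.mdifferentiableAt_symm hx)).mdifferentiableWithinAt⟩

theorem coord_eq {x : S} (hx : x ∈ c.chart.source) {v : TangentSpace 𝓘(ℝ, ℂ) x} {w : ℂ}
    (hw : mfderiv 𝓘(ℝ, ℂ) 𝓘(ℝ, ℂ) c.chart x v = w) :
    η.coord x v = c.chart x ^ (c.n - 1) * w := by
  rw [← hw]
  have h := hasMFDerivAt_restrictScalars (c.mdifferentiable.mdifferentiableAt hx).hasMFDerivAt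
  rw [h.mfderiv]
  exact c.form_eq x hx v

theorem coord_symm {z : ℂ} (hz : z ∈ c.chart.target) (u : ℂ) :
    η.coord (c.chart.symm z) (mfderiv 𝓘(ℝ, ℂ) 𝓘(ℝ, ℂ) c.chart.symm z u) = z ^ (c.n - 1) * u := by
  have h := c.coord_eq (c.chart.map_target hz) (w := u)
    (DFunLike.congr_fun (c.mdifferentiable_real.comp_symm_deriv hz) u)
  rwa [c.chart.right_inv hz] at h

theorem mem_zeros_iff (hσ : σ ∈ η.zeros) {x : S} (hx : x ∈ c.chart.source) :
    x ∈ η.zeros ↔ x = σ := by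
  refine ⟨fun h => ?_, fun h => h ▸ hσ⟩
  obtain ⟨v, hv⟩ := c.mdifferentiable_real.mfderiv_surjective hx (1 : ℂ)
  have h1 := c.coord_eq hx hv
  have h0 : η.form x = 0 := h
  rw [AbelianDifferential.coord, h0, mul_one] at h1
  have h2 : c.chart x ^ (c.n - 1) = 0 := h1.symm
  have h3 : c.chart x = c.chart σ := by
    rw [c.map_center]; exact eq_zero_of_pow_eq_zero h2
  exact c.chart.injOn hx c.mem_source h3

theorem chart_ne_zero {x : S} (hx : x ∈ c.chart.source) (hxσ : x ≠ σ) : c.chart x ≠ 0 := by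
  intro h
  exact hxσ (c.chart.injOn hx c.mem_source (h.trans c.map_center.symm))

theorem symm_zero : c.chart.symm 0 = σ := by
  rw [← c.map_center, c.chart.left_inv c.mem_source]

end ConeChart

/-- In a cone chart the form vanishes at most at the centre, so the zeros are isolated; they are
also closed in a compact surface. -/
theorem finite_zeros [IsManifold 𝓘(ℂ) ω S] [CompactSpace S] {η : AbelianDifferential S}
    (e : ∀ σ : η.zeros, ConeChart η σ.1) : Finite η.zeros := by
  refine (η.isClosed_zeros.isCompact.finite ?_).to_subtype
  refine isDiscrete_iff_discreteTopology.2 (discreteTopology_subtype_iff.2 ?_)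
  intro x hx
  rw [← disjoint_iff, disjoint_principal_right, mem_nhdsWithin]
  refine ⟨_, (e ⟨x, hx⟩).chart.open_source, (e ⟨x, hx⟩).mem_source, fun y hy hy' => hy.2 ?_⟩
  exact ((e ⟨x, hx⟩).mem_zeros_iff hx hy.1).1 hy'

/-- The differential in flat coordinates of a map that reads `φ ∘ z⁻¹ ∘ L ∘ z` in a cone chart,
where `L` lifts `T` through the branched cover and `φ` acts as `diagMap l`. -/
theorem ConeChart.hasMFDerivAt_comp {η : AbelianDifferential S} {σ : S} (c : ConeChart η σ)
    {l : ℝ} {φ : S → S} {L T : ℂ → ℂ} {D : ℂ →L[ℝ] ℂ} {x : S}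
    (hx : x ∈ c.chart.source) (hL : DifferentiableAt ℝ L (c.chart x))
    (hLx : L (c.chart x) ∈ c.chart.target)
    (hT : HasFDerivAt T D (c.chart x ^ c.n))
    (hLT : ∀ᶠ z in 𝓝 (c.chart x), L z ^ c.n = T (z ^ c.n))
    (hφ : MDifferentiableAt 𝓘(ℝ, ℂ) 𝓘(ℝ, ℂ) φ (c.chart.symm (L (c.chart x))))
    (hφ' : ∀ v : TangentSpace 𝓘(ℝ, ℂ) (c.chart.symm (L (c.chart x))),
        η.coord (φ (c.chart.symm (L (c.chart x)))) (mfderiv 𝓘(ℝ, ℂ) 𝓘(ℝ, ℂ) φ _ v) =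
          diagMap l (η.coord _ v)) :
    MDifferentiableAt 𝓘(ℝ, ℂ) 𝓘(ℝ, ℂ) (fun y => φ (c.chart.symm (L (c.chart y)))) x ∧
    ∀ v : TangentSpace 𝓘(ℝ, ℂ) x, η.coord (φ (c.chart.symm (L (c.chart x))))
      (mfderiv 𝓘(ℝ, ℂ) 𝓘(ℝ, ℂ) (fun y => φ (c.chart.symm (L (c.chart y)))) x v) =
        diagMap l (D (η.coord x v)) := by
  have h1 := (c.mdifferentiable_real.mdifferentiableAt hx).hasMFDerivAt
  have h2 : HasMFDerivAt 𝓘(ℝ, ℂ) 𝓘(ℝ, ℂ) L (c.chart x) _ := hL.hasFDerivAt.hasMFDerivAt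
  have h3 := (c.mdifferentiable_real.mdifferentiableAt_symm hLx).hasMFDerivAt
  have h4 := hφ.hasMFDerivAt.comp x (h3.comp x (h2.comp x h1))
  refine ⟨h4.mdifferentiableAt, fun v => ?_⟩
  have h5 : mfderiv 𝓘(ℝ, ℂ) 𝓘(ℝ, ℂ) (fun y => φ (c.chart.symm (L (c.chart y)))) x = _ := h4.mfderiv
  rw [h5]
  refine (hφ' _).trans ?_
  congr 1
  refine (c.coord_symm hLx _).trans ?_
  obtain ⟨u, hu⟩ : ∃ u : ℂ, mfderiv 𝓘(ℝ, ℂ) 𝓘(ℝ, ℂ) c.chart x v = u := ⟨_, rfl⟩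
  rw [c.coord_eq hx hu]
  suffices h : L (c.chart x) ^ (c.n - 1) * fderiv ℝ L (c.chart x) u =
      D (c.chart x ^ (c.n - 1) * u) by
    rw [← h, ← hu]
    rfl
  -- Differentiating `L z ^ n = T (z ^ n)` in two ways gives the identity up to the factor `n`: the
  -- flat coordinate is `z ^ n / n`, and `n` cancels.
  have h6 : HasFDerivAt (fun z => L z ^ c.n)
      ((c.n * L (c.chart x) ^ (c.n - 1)) • fderiv ℝ L (c.chart x)) (c.chart x) := by
    refine (hL.hasFDerivAt.pow c.n).congr_fderiv ?_
    ext1; simp [mul_assoc]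
  have h7 : HasFDerivAt (fun z : ℂ => z ^ c.n)
      ((c.n * c.chart x ^ (c.n - 1)) • ContinuousLinearMap.id ℝ ℂ) (c.chart x) := by
    refine ((hasFDerivAt_id (𝕜 := ℝ) (c.chart x)).pow c.n).congr_fderiv ?_
    ext1; simp
  have h8 := (HasFDerivAt.comp (f := fun z : ℂ => z ^ c.n) (c.chart x) hT h7).congr_of_eventuallyEq hLT
  have h9 := DFunLike.congr_fun (h6.unique h8) u
  have h10 : (c.n : ℂ) ≠ 0 := Nat.cast_ne_zero.2 c.n_pos.ne'
  apply mul_left_cancel₀ h10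
  have h11 : D (((c.n : ℂ) * c.chart x ^ (c.n - 1)) * u) = c.n * D (c.chart x ^ (c.n - 1) * u) := by
    have := D.map_smul (c.n : ℝ) (c.chart x ^ (c.n - 1) * u)
    simpa [mul_assoc] using this
  rw [← h11]
  simpa [mul_assoc] using h9

theorem ConeChart.hasFDerivAt_chart_comp {η : AbelianDifferential S} {σ : S} (c : ConeChart η σ)
    {l : ℝ} {φ : S → S} {z : ℂ} (hz : z ∈ c.chart.target)
    (hφz : φ (c.chart.symm z) ∈ c.chart.source)
    (hφ : MDifferentiableAt 𝓘(ℝ, ℂ) 𝓘(ℝ, ℂ) φ (c.chart.symm z))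
    (hφ' : ∀ v : TangentSpace 𝓘(ℝ, ℂ) (c.chart.symm z),
        η.coord (φ (c.chart.symm z)) (mfderiv 𝓘(ℝ, ℂ) 𝓘(ℝ, ℂ) φ _ v) =
          diagMap l (η.coord _ v)) :
    ∃ D : ℂ →L[ℝ] ℂ, HasFDerivAt (fun u => c.chart (φ (c.chart.symm u))) D z ∧
      ∀ v, c.chart (φ (c.chart.symm z)) ^ (c.n - 1) * D v = diagMap l (z ^ (c.n - 1) * v) := by
  have h1 := (c.mdifferentiable_real.mdifferentiableAt hφz).hasMFDerivAt
  have h3 := (c.mdifferentiable_real.mdifferentiableAt_symm hz).hasMFDerivAt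
  have h4 := HasMFDerivAt.comp z h1 (hφ.hasMFDerivAt.comp z h3)
  refine ⟨_, h4.hasFDerivAt, fun v => ?_⟩
  rw [← c.coord_symm hz]
  exact (c.coord_eq hφz rfl).symm.trans (hφ' _)

/-- `1` is an isolated `n`-th root of unity. This upgrades equality of `n`-th powers to equality on
the same sheet. -/
theorem eventually_eq_one_of_pow_eq_one {X : Type*} {F : Filter X} {u : X → ℂ} {n : ℕ}
    (hn : 0 < n) (hu : Tendsto u F (𝓝 1)) (hun : ∀ᶠ x in F, u x ^ n = 1) : ∀ᶠ x in F, u x = 1 := by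
  have h := (hasDerivAt_pow n (1 : ℂ)).eventually_ne (c := 1) (by simpa using hn.ne')
  rw [eventually_nhdsWithin_iff] at h
  filter_upwards [hu.eventually h, hun] with x h1 h2
  by_contra h3
  exact h1 h3 h2

/-- A linear pseudo-Anosov map respecting the sheets at `σ` reads as the lift of `diagMap l` at
every point of a disc around `σ` whose expected image is in the disc. -/
theorem ConeChart.apply_symm_eq [T2Space S] {η : AbelianDifferential S} {σ : S} (hσ : σ ∈ η.zeros)
    (c : ConeChart η σ) {l : ℝ} (hl : 0 < l) {φ : S → S} (hφc : Continuous φ)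
    (hφ : ∀ x ∉ η.zeros, MDifferentiableAt 𝓘(ℝ, ℂ) 𝓘(ℝ, ℂ) φ x ∧
      ∀ v : TangentSpace 𝓘(ℝ, ℂ) x,
        η.coord (φ x) (mfderiv 𝓘(ℝ, ℂ) 𝓘(ℝ, ℂ) φ x v) = diagMap l (η.coord x v))
    (hφσ : φ σ = σ)
    (hnear : ∀ᶠ x in 𝓝 σ, c.chart (φ x) = sheetLift c.n (diagMap l) (c.chart x))
    {r : ℝ} (hr : {z : ℂ | ‖z ^ c.n‖ ≤ r} ⊆ c.chart.target) {z : ℂ} (hz : ‖z ^ c.n‖ ≤ r)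
    (hz' : ‖diagMap l (z ^ c.n)‖ ≤ r) :
    φ (c.chart.symm z) = c.chart.symm (sheetLift c.n (diagMap l) z) := by
  rcases eq_or_ne z 0 with rfl | hz0
  · rw [sheetLift_zero, c.symm_zero, hφσ]
  set w := sheetLift c.n (diagMap l) z with hw
  have hwn : w ^ c.n = diagMap l (z ^ c.n) := sheetLift_pow c.n_pos hz0
  have hw0 : w ≠ 0 := sheetLift_ne_zero c.n_pos hz0 (diagMap_div_re_pos hl (pow_ne_zero _ hz0))
  have hseg : ∀ u : ℂ, ‖u ^ c.n‖ ≤ r → ∀ t ∈ Icc (0 : ℝ) 1, (t : ℂ) * u ∈ c.chart.target := by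
    intro u hu t ht
    apply hr
    rw [mem_ofPred_eq, mul_pow, norm_mul, norm_pow, Complex.norm_real, Real.norm_of_nonneg ht.1]
    exact (mul_le_of_le_one_left (norm_nonneg _) (pow_le_one₀ ht.1 ht.2)).trans hu
  have hzt := hseg z hz
  have hwt := hseg w (hwn ▸ hz')
  have hcont : ∀ u : ℂ, (∀ t ∈ Icc (0 : ℝ) 1, (t : ℂ) * u ∈ c.chart.target) →
      ContinuousOn (fun t : ℝ => c.chart.symm (t * u)) (Icc 0 1) := fun u hu =>
    c.chart.continuousOn_symm.comp (by fun_prop) hu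
  -- Continuation along the radius through `z`: the set of good times is closed, and a neighbourhood
  -- of each good `t < 1` is shown to be good.
  have hsub : Icc (0 : ℝ) 1 ⊆ {t | φ (c.chart.symm (t * z)) = c.chart.symm (t * w)} := by
    have hclosed : IsClosed ({t : ℝ | φ (c.chart.symm (t * z)) = c.chart.symm (t * w)} ∩ Icc 0 1) := by
      have := isClosed_Icc.isClosed_eq (hφc.comp_continuousOn (hcont z hzt)) (hcont w hwt)
      rwa [inter_comm]
    refine hclosed.Icc_subset_of_forall_mem_nhdsWithin ?_ ?_
    · simp [c.symm_zero, hφσ]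
    rintro t ⟨ht, ht0, ht1⟩
    apply mem_nhdsWithin_of_mem_nhds
    have htI : t ∈ Icc (0 : ℝ) 1 := ⟨ht0, ht1.le⟩
    have hmul : ∀ (u : ℂ) (s : ℝ), ContinuousAt (fun s : ℝ => (s : ℂ) * u) s := fun u s => by
      fun_prop
    have hev : ∀ᶠ s : ℝ in 𝓝 t, (s : ℂ) * z ∈ c.chart.target :=
      hmul z t (c.chart.open_target.mem_nhds (hzt t htI))
    have hsym : ContinuousAt (fun s : ℝ => c.chart.symm (s * z)) t :=
      ContinuousAt.comp (f := fun s : ℝ => (s : ℂ) * z)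
        (c.chart.continuousAt_symm (hzt t htI)) (hmul z t)
    have hφsym : ContinuousAt (fun s : ℝ => φ (c.chart.symm (s * z))) t :=
      ContinuousAt.comp (f := fun s : ℝ => c.chart.symm (s * z)) hφc.continuousAt hsym
    have ht' : φ (c.chart.symm (t * z)) = c.chart.symm (t * w) := ht
    have hsrc : ∀ᶠ s : ℝ in 𝓝 t, φ (c.chart.symm (s * z)) ∈ c.chart.source := by
      apply hφsym (c.chart.open_source.mem_nhds _)
      simp only [ht']; exact c.chart.map_target (hwt t htI)
    suffices h : ∀ᶠ s : ℝ in 𝓝 t, c.chart (φ (c.chart.symm (s * z))) = s * w by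
      filter_upwards [h, hsrc] with s h1 h2
      rw [← h1, c.chart.left_inv h2]
    rcases ht0.eq_or_lt with rfl | ht0
    -- The start of the radius is the only place where the assumed behaviour near `σ` is used; it
    -- selects the sheet.
    · have h1 : Tendsto (fun s : ℝ => c.chart.symm (s * z)) (𝓝 0) (𝓝 σ) := by
        simpa [ContinuousAt, c.symm_zero] using hsym
      filter_upwards [h1.eventually hnear, hev] with s h2 h3
      rw [h2, c.chart.right_inv h3, sheetLift_diagMap_smul]
    have hpos : ∀ᶠ s : ℝ in 𝓝 t, 0 < s := lt_mem_nhds ht0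
    obtain ⟨δ, hδ, hball⟩ := Metric.eventually_nhds_iff_ball.1 (hev.and (hsrc.and hpos))
    -- Away from the conical point `φ` acts as `diagMap l` in flat coordinates, so both `n`-th
    -- powers have the same derivative in `s`, namely `n s ^ (n - 1) w ^ n`.
    have hderiv : ∀ s ∈ Metric.ball t δ, HasDerivAt (fun s : ℝ =>
        c.chart (φ (c.chart.symm (s * z))) ^ c.n - ((s : ℂ) * w) ^ c.n) 0 s := by
      intro s hs
      obtain ⟨h1, h2, h3⟩ := hball s hs
      have h4 : c.chart.symm (s * z) ∉ η.zeros := by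
        rw [c.mem_zeros_iff hσ (c.chart.map_target h1)]
        intro h5
        have h6 := c.chart.right_inv h1
        rw [h5, c.map_center] at h6
        exact mul_ne_zero (Complex.ofReal_ne_zero.2 h3.ne') hz0 h6.symm
      obtain ⟨D, hD, hD'⟩ := c.hasFDerivAt_chart_comp h1 h2 (hφ _ h4).1 (hφ _ h4).2
      have h5 : ∀ u : ℂ, HasDerivAt (fun s : ℝ => (s : ℂ) * u) u s := fun u => by
        simpa using (Complex.ofRealCLM.hasDerivAt (x := s)).mul_const u
      have h6 := (hD.comp_hasDerivAt s (h5 z)).pow c.n |>.sub ((h5 w).pow c.n)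
      refine h6.congr_deriv ?_
      have h7 : diagMap l ((s * z) ^ (c.n - 1) * z) = (s : ℂ) ^ (c.n - 1) * w ^ c.n := by
        rw [hwn, mul_pow, mul_assoc, ← pow_succ, Nat.sub_add_cancel c.n_pos,
          ← Complex.ofReal_pow]
        generalize s ^ (c.n - 1) = q
        apply Complex.ext <;> simp [diagMap] <;> ring
      have h8 := (hD' z).trans h7
      rw [mul_assoc, Function.comp_apply, h8, mul_assoc, mul_pow, mul_assoc, ← pow_succ,
        Nat.sub_add_cancel c.n_pos, sub_self]
    have hpow : ∀ᶠ s : ℝ in 𝓝 t, c.chart (φ (c.chart.symm (s * z))) ^ c.n = ((s : ℂ) * w) ^ c.n := by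
      filter_upwards [Metric.ball_mem_nhds t hδ] with s hs
      have h1 := (convex_ball t δ).norm_image_sub_le_of_norm_hasDerivWithin_le (C := 0)
        (fun u hu => (hderiv u hu).hasDerivWithinAt) (fun _ _ => by simp)
        (Metric.mem_ball_self hδ) hs
      rw [ht', c.chart.right_inv (hwt t htI), zero_mul, sub_self, sub_zero, norm_le_zero_iff] at h1
      exact sub_eq_zero.1 h1
    have hne : ∀ s : ℝ, 0 < s → (s : ℂ) * w ≠ 0 := fun s hs =>
      mul_ne_zero (Complex.ofReal_ne_zero.2 hs.ne') hw0
    -- The two `n`-th powers agree near `t`, so the quotient is an `n`-th root of unity; it is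
    -- continuous and equals `1` at `t`.
    have hquot := eventually_eq_one_of_pow_eq_one
      (u := fun s : ℝ => c.chart (φ (c.chart.symm (s * z))) / (s * w)) (F := 𝓝 t) c.n_pos ?_ ?_
    · filter_upwards [hquot, hpos] with s h1 h2
      exact (div_eq_one_iff_eq (hne s h2)).1 h1
    · have h1 : ContinuousAt (fun s : ℝ => c.chart (φ (c.chart.symm (s * z)))) t :=
        ContinuousAt.comp (f := fun s : ℝ => φ (c.chart.symm (s * z)))
          (c.chart.continuousAt hsrc.self_of_nhds) hφsym
      have h2 := h1.div (hmul w t) (hne t ht0)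
      have h3 : c.chart (φ (c.chart.symm (t * z))) / (t * w) = 1 := by
        rw [ht', c.chart.right_inv (hwt t htI), div_self (hne t ht0)]
      rw [← h3]
      exact h2
    · filter_upwards [hpow, hpos] with s h1 h2
      rw [div_pow, h1, div_self (pow_ne_zero _ (hne s h2))]
  have := hsub (right_mem_Icc.2 zero_le_one)
  simpa using this

end

/-! ### Geometric decay of the series along abstract orbits -/

section

/-- The terms `l⁻ⁱ B(fⁱ x) ∏_{j ≤ i} A(fʲ x)⁻¹`. -/
def seriesTerm {X : Type*} (l : ℝ) (f : X → X) (A B : X → ℝ) (i : ℕ) (x : X) : ℝ :=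
  (l ^ i)⁻¹ * B (f^[i] x) * ∏ j ∈ Finset.range (i + 1), (A (f^[j] x))⁻¹

theorem seriesTerm_succ {X : Type*} (l : ℝ) (f : X → X) (A B : X → ℝ) (i : ℕ) (x : X) :
    seriesTerm l f A B (i + 1) x = l⁻¹ * (A x)⁻¹ * seriesTerm l f A B i (f x) := by
  simp only [seriesTerm, Finset.prod_range_succ' _ (i + 1), Function.iterate_succ_apply,
    Function.iterate_zero, id, pow_succ, mul_inv]
  ring

/-- Uniform geometric decay of the terms of the series. A point either lies outside the discs,
where `A = l` and `B = 0`, or has a coordinate `w` in a disc of radius `r`; then its image has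
coordinate `g Re w + i l⁻¹ Im w`, unless this point is not in the disc any more. Weak expansion
(`g < l⁻¹`) is compensated by the expansion needed to leave the disc in the course of a complete
stay, and by the decay of `B` in the course of an incomplete one. -/
theorem abs_seriesTerm_le {X : Type*} {l a₀ C : ℝ} (hl : 1 < l) (ha₀ : (l ^ 2)⁻¹ < a₀)
    (hC : 0 ≤ C) {f : X → X} {A B : X → ℝ} (D : X → ℝ → ℂ → Prop)
    (hout : ∀ x, (A x = l ∧ B x = 0) ∨ ∃ r w, D x r w)
    (hD : ∀ x r w, D x r w → 0 < r ∧ ‖w‖ ≤ r ∧ |B x| ≤ C * (|w.im| / r) ∧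
      ∃ g, a₀ ≤ g ∧ g ≤ A x ∧
        (r < ‖(⟨g * w.re, l⁻¹ * w.im⟩ : ℂ)‖ ∨ D (f x) r ⟨g * w.re, l⁻¹ * w.im⟩)) (i : ℕ) (x : X) :
    |seriesTerm l f A B i x| ≤ C / a₀ * max l⁻¹ ((l ^ 2)⁻¹ / a₀) ^ i := by
  have hl0 : 0 < l := one_pos.trans hl
  have ha : 0 < a₀ := lt_trans (by positivity) ha₀
  set ρ := max l⁻¹ ((l ^ 2)⁻¹ / a₀) with hρ
  have hρ1 : l⁻¹ ≤ ρ := le_max_left _ _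
  have hρ2 : (l ^ 2)⁻¹ / a₀ ≤ ρ := le_max_right _ _
  have hρ0 : 0 < ρ := (inv_pos.2 hl0).trans_le hρ1
  have hl1 : l⁻¹ ≤ 1 := inv_le_one_of_one_le₀ hl.le
  set K := C / a₀ with hK
  have hK0 : 0 ≤ K := div_nonneg hC ha.le
  -- Strengthened induction: `t` bounds `|Re w|` as a fraction of the half-chord at height `Im w`.
  -- The weight is at most `1`, and its smallness pays for the weak expansion still to come.
  suffices h : (∀ x, |seriesTerm l f A B i x| ≤ K * ρ ^ i) ∧
      ∀ x r w, D x r w → ∀ t ∈ Icc (0 : ℝ) 1, w.re ^ 2 ≤ t ^ 2 * (r ^ 2 - w.im ^ 2) →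
        |seriesTerm l f A B i x| ≤ K * ρ ^ i * max t (|w.im| / r) from h.1 x
  have hsq : ∀ (r : ℝ) (w : ℂ), 0 < r → (‖w‖ ≤ r ↔ w.re ^ 2 + w.im ^ 2 ≤ r ^ 2) := by
    intro r w hr
    rw [Complex.norm_eq_sqrt_sq_add_sq, Real.sqrt_le_left hr.le]
  have hone : ∀ x r w, D x r w → w.re ^ 2 ≤ (1 : ℝ) ^ 2 * (r ^ 2 - w.im ^ 2) ∧ |w.im| / r ≤ 1 := by
    intro x r w h
    obtain ⟨hr, hw, -⟩ := hD x r w h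
    refine ⟨by linarith [(hsq r w hr).1 hw], ?_⟩
    rw [div_le_one hr]
    exact (Complex.abs_im_le_norm w).trans hw
  have hA : ∀ x r w, D x r w → 0 < A x := by
    intro x r w h
    obtain ⟨-, -, -, g, hg, hgA, -⟩ := hD x r w h
    linarith
  -- the second bound implies the first one
  have hreduce : ∀ i, (∀ x, A x = l ∧ B x = 0 → |seriesTerm l f A B i x| ≤ K * ρ ^ i) →
      (∀ x r w, D x r w → ∀ t ∈ Icc (0 : ℝ) 1, w.re ^ 2 ≤ t ^ 2 * (r ^ 2 - w.im ^ 2) →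
        |seriesTerm l f A B i x| ≤ K * ρ ^ i * max t (|w.im| / r)) →
      ∀ x, |seriesTerm l f A B i x| ≤ K * ρ ^ i := by
    intro i h1 h2 x
    rcases hout x with h | ⟨r, w, h⟩
    · exact h1 x h
    · have := h2 x r w h 1 ⟨zero_le_one, le_rfl⟩ (hone x r w h).1
      rwa [max_eq_left (hone x r w h).2, mul_one] at this
  induction i with
  | zero =>
    suffices h : ∀ x r w, D x r w → ∀ t ∈ Icc (0 : ℝ) 1, w.re ^ 2 ≤ t ^ 2 * (r ^ 2 - w.im ^ 2) →
        |seriesTerm l f A B 0 x| ≤ K * ρ ^ 0 * max t (|w.im| / r) by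
      refine ⟨hreduce 0 (fun x hx => ?_) h, h⟩
      simpa [seriesTerm, hx.2] using hK0
    intro x r w h t ht _
    obtain ⟨hr, hw, hB, g, hg, hgA, -⟩ := hD x r w h
    have hAx := hA x r w h
    calc |seriesTerm l f A B 0 x| = |B x| * (A x)⁻¹ := by
          simp [seriesTerm, abs_mul, abs_inv, abs_of_pos hAx]
      _ ≤ C * (|w.im| / r) * a₀⁻¹ := by
          gcongr
          linarith
      _ = K * ρ ^ 0 * (|w.im| / r) := by rw [hK, pow_zero]; ring
      _ ≤ _ := by gcongr; exact le_max_right _ _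
  | succ i ih =>
    obtain ⟨ih1, ih2⟩ := ih
    suffices h : ∀ x r w, D x r w → ∀ t ∈ Icc (0 : ℝ) 1, w.re ^ 2 ≤ t ^ 2 * (r ^ 2 - w.im ^ 2) →
        |seriesTerm l f A B (i + 1) x| ≤ K * ρ ^ (i + 1) * max t (|w.im| / r) by
      refine ⟨hreduce (i + 1) (fun x hx => ?_) h, h⟩
      rw [seriesTerm_succ, abs_mul, hx.1, abs_of_pos (by positivity)]
      calc l⁻¹ * l⁻¹ * |seriesTerm l f A B i (f x)| ≤ ρ * 1 * (K * ρ ^ i) := by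
            gcongr
            exact ih1 _
        _ = K * ρ ^ (i + 1) := by ring
    intro x r w h t ht hwt
    obtain ⟨hr, hw, hB, g, hg, hgA, hstep⟩ := hD x r w h
    have hAx := hA x r w h
    have ht0 := ht.1
    have hg0 : 0 < g := ha.trans_le hg
    have hgi : (A x)⁻¹ ≤ g⁻¹ := inv_anti₀ hg0 hgA
    have him : (l⁻¹ * w.im) ^ 2 ≤ w.im ^ 2 := by
      rw [mul_pow]
      exact mul_le_of_le_one_left (sq_nonneg _) (pow_le_one₀ (by positivity) hl1)
    have hwr := (hsq r w hr).1 hw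
    rw [seriesTerm_succ, abs_mul, abs_of_pos (by positivity : 0 < l⁻¹ * (A x)⁻¹)]
    rcases hstep with hexit | hstay
    · have h1 : r ^ 2 < (g * w.re) ^ 2 + (l⁻¹ * w.im) ^ 2 := by
        have := mt (hsq r ⟨g * w.re, l⁻¹ * w.im⟩ hr).2 (not_le.2 hexit)
        simpa using this
      -- Leaving the disc means overshooting the chord: if `g t ≤ 1`, the image would stay within
      -- the chord at height `Im w`, and lowering the height to `l⁻¹ Im w` only helps.
      have h2 : 1 < g * t := by
        by_contra h3
        push Not at h3
        have h4 : (g * t) ^ 2 ≤ 1 := pow_le_one₀ (mul_nonneg hg0.le ht.1) h3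
        have h5 : (g * w.re) ^ 2 ≤ r ^ 2 - w.im ^ 2 := by
          calc (g * w.re) ^ 2 = g ^ 2 * w.re ^ 2 := by ring
            _ ≤ g ^ 2 * (t ^ 2 * (r ^ 2 - w.im ^ 2)) := by gcongr
            _ = (g * t) ^ 2 * (r ^ 2 - w.im ^ 2) := by ring
            _ ≤ 1 * (r ^ 2 - w.im ^ 2) := by
              gcongr
              nlinarith [sq_nonneg w.re]
            _ = _ := one_mul _
        linarith
      have h3 : g⁻¹ ≤ t := by
        rw [inv_le_iff_one_le_mul₀ hg0]; linarith
      calc l⁻¹ * (A x)⁻¹ * |seriesTerm l f A B i (f x)| ≤ ρ * t * (K * ρ ^ i) := by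
            have h4 := hgi.trans h3
            have h5 := ih1 (f x)
            gcongr
        _ = K * ρ ^ (i + 1) * t := by ring
        _ ≤ _ := by gcongr; exact le_max_left _ _
    -- The relative position grows at most by `g`, since the chord gets longer as the height
    -- shrinks; the cap at `1` is available because the image is in the disc.
    · set t' := min 1 (g * t) with ht'
      have ht'0 : 0 ≤ t' := le_min zero_le_one (mul_nonneg hg0.le ht.1)
      have hs := hone _ _ _ hstay
      simp only at hs
      have h1 : (g * w.re) ^ 2 ≤ t' ^ 2 * (r ^ 2 - (l⁻¹ * w.im) ^ 2) := by
        rcases le_total 1 (g * t) with h2 | h2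
        · rw [ht', min_eq_left h2]; exact hs.1
        · rw [ht', min_eq_right h2]
          calc (g * w.re) ^ 2 = g ^ 2 * w.re ^ 2 := by ring
            _ ≤ g ^ 2 * (t ^ 2 * (r ^ 2 - w.im ^ 2)) := by gcongr
            _ = (g * t) ^ 2 * (r ^ 2 - w.im ^ 2) := by ring
            _ ≤ _ := by gcongr
      have h2 := ih2 (f x) r _ hstay t' ⟨ht'0, min_le_left _ _⟩ h1
      simp only at h2
      rw [abs_mul, abs_of_pos (inv_pos.2 hl0)] at h2
      -- In the first entry the growth `g` of `t` absorbs `(A x)⁻¹`, leaving `l⁻¹`; in the second,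
      -- the contraction of `Im w` supplies the other `l⁻¹`, giving `l⁻² / a₀`.
      have h3 : l⁻¹ * (A x)⁻¹ * max t' (l⁻¹ * |w.im| / r) ≤ ρ * max t (|w.im| / r) := by
        rw [mul_max_of_nonneg _ _ (by positivity), mul_max_of_nonneg _ _ hρ0.le]
        apply max_le_max
        · calc l⁻¹ * (A x)⁻¹ * t' ≤ ρ * g⁻¹ * (g * t) := by
                gcongr
                exact min_le_right _ _
            _ = ρ * t := by field_simp
        · calc l⁻¹ * (A x)⁻¹ * (l⁻¹ * |w.im| / r) ≤ l⁻¹ * a₀⁻¹ * (l⁻¹ * |w.im| / r) := by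
                gcongr
                linarith
            _ = (l ^ 2)⁻¹ / a₀ * (|w.im| / r) := by field_simp
            _ ≤ _ := by gcongr
      calc l⁻¹ * (A x)⁻¹ * |seriesTerm l f A B i (f x)|
          ≤ l⁻¹ * (A x)⁻¹ * (K * ρ ^ i * max t' (l⁻¹ * |w.im| / r)) := by gcongr
        _ = K * ρ ^ i * (l⁻¹ * (A x)⁻¹ * max t' (l⁻¹ * |w.im| / r)) := by ring
        _ ≤ K * ρ ^ i * (ρ * max t (|w.im| / r)) := by gcongr
        _ = _ := by ring

end

/-! ### The perturbed map on the surface and its coefficients -/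

section

variable {S : Type*} [TopologicalSpace S] [ChartedSpace ℂ S] {η : AbelianDifferential S}

/-- The closed disc `|z ^ n| ≤ r` of a cone chart. -/
def ConeChart.disc {σ : S} (c : ConeChart η σ) (r : ℝ) : Set S :=
  {x | x ∈ c.chart.source ∧ ‖c.chart x ^ c.n‖ ≤ r}

theorem ConeChart.isClosed_disc [T2Space S] {σ : S} (c : ConeChart η σ) {r : ℝ}
    (hr : {z : ℂ | ‖z ^ c.n‖ ≤ r} ⊆ c.chart.target) : IsClosed (c.disc r) := by
  have h1 : c.disc r = c.chart.symm '' {z : ℂ | ‖z ^ c.n‖ ≤ r} := by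
    ext x
    constructor
    · rintro ⟨h1, h2⟩
      exact ⟨_, h2, c.chart.left_inv h1⟩
    · rintro ⟨z, hz, rfl⟩
      refine ⟨c.chart.map_target (hr hz), ?_⟩
      rw [c.chart.right_inv (hr hz)]
      exact hz
  have h2 : IsCompact {z : ℂ | ‖z ^ c.n‖ ≤ r} := by
    refine Metric.isCompact_of_isClosed_isBounded (isClosed_le (by fun_prop) continuous_const) ?_
    refine isBounded_iff_forall_norm_le.2 ⟨max 1 r, fun z hz => ?_⟩
    rcases le_total ‖z‖ 1 with h | h
    · exact h.trans (le_max_left _ _)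
    · refine (le_self_pow₀ h c.n_pos.ne').trans ?_
      rw [← norm_pow]
      exact le_trans hz (le_max_right _ _)
  rw [h1]
  exact (h2.image_of_continuousOn (c.chart.continuousOn_symm.mono hr)).isClosed

variable {e : ∀ σ : η.zeros, ConeChart η σ.1} {l : ℝ} {k : η.zeros → ℝ → ℝ} {α β : η.zeros → ℝ}

theorem eq_of_mem_source
    (hdisj : Pairwise fun σ τ => Disjoint (e σ).chart.source (e τ).chart.source) {σ τ : η.zeros}
    {x : S} (hσ : x ∈ (e σ).chart.source) (hτ : x ∈ (e τ).chart.source) : σ = τ := by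
  by_contra h
  exact disjoint_left.1 (hdisj h) hσ hτ

/-- The formula holds on the whole chart domain, not only on the disc, because the lift is the
identity beyond radius `α σ`. This open domain makes differentiation across the boundary circle
harmless. -/
theorem pertMap_of_mem
    (hdisj : Pairwise fun σ τ => Disjoint (e σ).chart.source (e τ).chart.source)
    (hk : ∀ σ, IsProfile (k σ)) (hα : ∀ σ, 0 < α σ) (hl : l ≠ 0) (φ : S ≃ₜ S) {σ : η.zeros}
    {x : S} (hx : x ∈ (e σ).chart.source) :
    pertMap η e l φ k α β x = φ ((e σ).chart.symm
      (sheetLift (e σ).n (discMap l (β σ) (α σ) (k σ)) ((e σ).chart x))) := by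
  by_cases h : ∃ σ : η.zeros, x ∈ (e σ).chart.source ∧ ‖(e σ).chart x ^ (e σ).n‖ ≤ α σ
  · rw [pertMap, dif_pos h]
    obtain rfl := eq_of_mem_source hdisj hx h.choose_spec.1
    rfl
  · rw [pertMap, dif_neg h, sheetLift_of_eq, (e σ).chart.left_inv hx]
    apply discMap_of_le hl (hα σ) (hk σ)
    exact (not_le.1 fun h' => h ⟨σ, hx, h'⟩).le

theorem pertMap_of_notMem (φ : S ≃ₜ S) {x : S} (hx : ∀ σ, x ∉ (e σ).disc (α σ)) :
    pertMap η e l φ k α β x = φ x :=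
  dif_neg fun ⟨σ, h⟩ => hx σ h

open Classical in
/-- The function equal to `g σ` on the domain of the cone chart at `σ` and to `c` elsewhere. -/
def glue {Y : Type*} (e : ∀ σ : η.zeros, ConeChart η σ.1) (g : η.zeros → S → Y) (c : Y) (x : S) :
    Y :=
  if h : ∃ σ : η.zeros, x ∈ (e σ).chart.source then g h.choose x else c

theorem glue_of_mem {Y : Type*}
    (hdisj : Pairwise fun σ τ => Disjoint (e σ).chart.source (e τ).chart.source)
    (g : η.zeros → S → Y) (c : Y) {σ : η.zeros} {x : S} (hx : x ∈ (e σ).chart.source) :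
    glue e g c x = g σ x := by
  have h : ∃ σ : η.zeros, x ∈ (e σ).chart.source := ⟨σ, hx⟩
  rw [glue, dif_pos h, ← eq_of_mem_source hdisj hx h.choose_spec]

theorem glue_of_notMem {Y : Type*} {g : η.zeros → S → Y} {c : Y} {x : S}
    (hg : ∀ σ, x ∈ (e σ).chart.source → α σ ≤ ‖(e σ).chart x ^ (e σ).n‖ → g σ x = c)
    (hx : ∀ σ, x ∉ (e σ).disc (α σ)) : glue e g c x = c := by
  by_cases h : ∃ σ : η.zeros, x ∈ (e σ).chart.source
  · rw [glue, dif_pos h]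
    exact hg _ h.choose_spec (not_le.1 fun h' => hx _ ⟨h.choose_spec, h'⟩).le
  · rw [glue, dif_neg h]

theorem isOpen_compl_discs [T2Space S] [Finite η.zeros]
    (hdisc : ∀ σ, {z : ℂ | ‖z ^ (e σ).n‖ ≤ α σ} ⊆ (e σ).chart.target) :
    IsOpen {x | ∀ σ, x ∉ (e σ).disc (α σ)} := by
  have : {x | ∀ σ, x ∉ (e σ).disc (α σ)} = (⋃ σ, (e σ).disc (α σ))ᶜ := by
    ext; simp
  rw [this]
  exact (isClosed_iUnion_of_finite fun σ => (e σ).isClosed_disc (hdisc σ)).isOpen_compl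

/-- A map is continuous if it is so on the domains of the cone charts and off the discs. -/
theorem continuous_of_discs [T2Space S] [Finite η.zeros]
    (hdisc : ∀ σ, {z : ℂ | ‖z ^ (e σ).n‖ ≤ α σ} ⊆ (e σ).chart.target)
    {X Y : Type*} [TopologicalSpace X] [TopologicalSpace Y] {F c : X × S → Y}
    {g : η.zeros → X × S → Y} (hg : ∀ σ, ContinuousOn (g σ) {p | p.2 ∈ (e σ).chart.source})
    (hc : Continuous c) (hFg : ∀ σ p, p.2 ∈ (e σ).chart.source → F p = g σ p)
    (hFc : ∀ p, (∀ σ, p.2 ∉ (e σ).disc (α σ)) → F p = c p) : Continuous F := by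
  refine continuous_iff_continuousAt.2 fun p => ?_
  by_cases h : ∀ σ, p.2 ∉ (e σ).disc (α σ)
  · refine hc.continuousAt.congr_of_eventuallyEq ?_
    filter_upwards [((isOpen_compl_discs hdisc).preimage continuous_snd).mem_nhds h] with q hq
    exact hFc q hq
  · push Not at h
    obtain ⟨σ, hσ, -⟩ := h
    have hs : {q : X × S | q.2 ∈ (e σ).chart.source} ∈ 𝓝 p :=
      ((e σ).chart.open_source.preimage continuous_snd).mem_nhds hσ
    refine ((hg σ).continuousAt hs).congr_of_eventuallyEq ?_
    filter_upwards [hs] with q hq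
    exact hFg σ q hq

/-- The coefficient `a` of the perturbed map, extended continuously to the conical points. -/
def contA (e : ∀ σ : η.zeros, ConeChart η σ.1) (l : ℝ) (k : η.zeros → ℝ → ℝ) (α β : η.zeros → ℝ) :
    S → ℝ :=
  glue e (fun σ x => modelA l (β σ) (α σ) (k σ) ((e σ).chart x ^ (e σ).n)) l

/-- The coefficient `b` of the perturbed map, extended continuously to the conical points. -/
def contB (e : ∀ σ : η.zeros, ConeChart η σ.1) (k : η.zeros → ℝ → ℝ) (α β : η.zeros → ℝ) :
    S → ℝ :=
  glue e (fun σ x => modelB (β σ) (α σ) (k σ) ((e σ).chart x ^ (e σ).n)) 0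

theorem contA_of_notMem (hk : ∀ σ, IsProfile (k σ)) (hα : ∀ σ, 0 < α σ) {x : S}
    (hx : ∀ σ, x ∉ (e σ).disc (α σ)) : contA e l k α β x = l :=
  glue_of_notMem (fun σ _ h => modelA_of_le (hα σ) (hk σ) h) hx

theorem contB_of_notMem (hk : ∀ σ, IsProfile (k σ)) (hα : ∀ σ, 0 < α σ) {x : S}
    (hx : ∀ σ, x ∉ (e σ).disc (α σ)) : contB e k α β x = 0 :=
  glue_of_notMem (fun σ _ h => modelB_of_le (hα σ) (hk σ) h) hx

/-- Differentiability and derivative of the perturbed map off the conical points. -/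
theorem pertMap_spec [T2Space S] [Finite η.zeros] {φ : S ≃ₜ S} (hφ : IsLinearPseudoAnosov η l φ)
    (hdisj : Pairwise fun σ τ => Disjoint (e σ).chart.source (e τ).chart.source)
    (hk : ∀ σ, IsProfile (k σ)) (hα : ∀ σ, 0 < α σ)
    (hdisc : ∀ σ, {z : ℂ | ‖z ^ (e σ).n‖ ≤ α σ} ⊆ (e σ).chart.target)
    (hβ : ∀ σ, β σ ≤ 0) (hlβ : ∀ σ, 0 < l + β σ) {x : S} (hx : x ∉ η.zeros) :
    pertMap η e l φ k α β x ∉ η.zeros ∧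
      MDifferentiableAt 𝓘(ℝ, ℂ) 𝓘(ℝ, ℂ) (pertMap η e l φ k α β) x ∧
      coefA η (pertMap η e l φ k α β) x = contA e l k α β x ∧
      coefB η (pertMap η e l φ k α β) x = contB e k α β x := by
  have hl : 0 < l := one_pos.trans hφ.1
  have hφz : ∀ y ∉ η.zeros, φ y ∉ η.zeros := by
    intro y hy h
    rw [← hφ.2.1] at h
    obtain ⟨u, hu, hu'⟩ := h
    exact hy (φ.injective hu' ▸ hu)
  have hV : η.coord x (η.eV x) = 1 := η.coord_vec hx _
  have hH : η.coord x (η.eH x) = Complex.I := η.coord_vec hx _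
  by_cases hxd : ∀ σ, x ∉ (e σ).disc (α σ)
  · have hev : pertMap η e l φ k α β =ᶠ[𝓝 x] φ := by
      filter_upwards [(isOpen_compl_discs hdisc).mem_nhds hxd] with y hy
      exact pertMap_of_notMem φ hy
    obtain ⟨h1, h2⟩ := hφ.2.2 x hx
    have h3 := h1.hasMFDerivAt.congr_of_eventuallyEq hev
    have h4 : ∀ v : TangentSpace 𝓘(ℝ, ℂ) x, η.coord (pertMap η e l φ k α β x)
        (mfderiv 𝓘(ℝ, ℂ) 𝓘(ℝ, ℂ) (pertMap η e l φ k α β) x v) = diagMap l (η.coord x v) := by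
      intro v
      rw [h3.mfderiv, ← h2 v, hev.self_of_nhds]
    refine ⟨hev.self_of_nhds ▸ hφz x hx, h3.mdifferentiableAt, ?_, ?_⟩
    · rw [coefA, h4, hV, contA_of_notMem hk hα hxd]; simp [diagMap]
    · rw [coefB, h4, hH, contB_of_notMem hk hα hxd]; simp [diagMap]
  · push Not at hxd
    obtain ⟨σ, hxs, hxα⟩ := hxd
    set c := e σ with hc
    set L := sheetLift c.n (discMap l (β σ) (α σ) (k σ)) with hL
    have hev : pertMap η e l φ k α β =ᶠ[𝓝 x] fun y => φ (c.chart.symm (L (c.chart y))) := by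
      filter_upwards [c.chart.open_source.mem_nhds hxs] with y hy
      exact pertMap_of_mem hdisj hk hα hl.ne' φ hy
    have hz0 : c.chart x ≠ 0 := c.chart_ne_zero hxs fun h => hx (h ▸ σ.2)
    have hξ0 : c.chart x ^ c.n ≠ 0 := pow_ne_zero _ hz0
    have hpos : ∀ w ≠ 0, 0 < (discMap l (β σ) (α σ) (k σ) w / w).re := fun w hw =>
      discMap_div_re_pos hl hw ((hlβ σ).trans_le (add_le_gain (hα σ) (hβ σ) (hk σ) w))
    obtain ⟨D, hD, hD1, hDI⟩ := hasFDerivAt_modelMap (l := l) (b := β σ) (r := α σ) (hk σ) hξ0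
    have hD' : HasFDerivAt (discMap l (β σ) (α σ) (k σ)) ((diagCLM l⁻¹).comp D)
        (c.chart x ^ c.n) := by
      refine ((diagCLM l⁻¹).hasFDerivAt.comp _ hD).congr_of_eventuallyEq ?_
      exact Eventually.of_forall fun w => (diagCLM_apply _ _).symm
    have hpow := fun z => sheetLift_pow_of_zero c.n_pos (discMap_zero l (β σ) (α σ) (k σ)) z
    have hLt : L (c.chart x) ∈ c.chart.target := by
      apply hdisc σ
      change ‖L (c.chart x) ^ c.n‖ ≤ α σ
      rw [hL, hpow]
      exact (norm_discMap_le hl (hα σ) (hβ σ) (hlβ σ) (hk σ) _).trans hxα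
    have hLz : c.chart.symm (L (c.chart x)) ∉ η.zeros := by
      rw [c.mem_zeros_iff σ.2 (c.chart.map_target hLt)]
      intro h
      have h1 := c.chart.right_inv hLt
      rw [h, c.map_center] at h1
      exact sheetLift_ne_zero c.n_pos hz0 (hpos _ hξ0) h1.symm
    obtain ⟨h1, h2⟩ := c.hasMFDerivAt_comp (l := l) (φ := φ) hxs
      (differentiableAt_sheetLift hz0 hD'.differentiableAt (hpos _ hξ0)) hLt hD'
      (Eventually.of_forall hpow) (hφ.2.2 _ hLz).1 (hφ.2.2 _ hLz).2
    have h3 := h1.hasMFDerivAt.congr_of_eventuallyEq hev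
    have h4 : ∀ v : TangentSpace 𝓘(ℝ, ℂ) x, η.coord (pertMap η e l φ k α β x)
        (mfderiv 𝓘(ℝ, ℂ) 𝓘(ℝ, ℂ) (pertMap η e l φ k α β) x v) = D (η.coord x v) := by
      intro v
      have h5 : diagMap l ((diagCLM l⁻¹).comp D (η.coord x v)) = D (η.coord x v) := by
        rw [ContinuousLinearMap.comp_apply, diagCLM_apply]
        apply Complex.ext <;> simp only [diagMap] <;> field_simp
      rw [← h5, ← h2 v, h3.mfderiv, hev.self_of_nhds]
    refine ⟨hev.self_of_nhds ▸ hφz _ hLz, h3.mdifferentiableAt, ?_, ?_⟩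
    · rw [coefA, h4, hV, hD1, contA, glue_of_mem hdisj _ _ hxs]
    · rw [coefB, h4, hH, hDI, contB, glue_of_mem hdisj _ _ hxs]

/-- The series defining the stable field has the same terms in the extended coefficients. -/
theorem stableTerm_eq [T2Space S] [Finite η.zeros] {φ : S ≃ₜ S} (hφ : IsLinearPseudoAnosov η l φ)
    (hdisj : Pairwise fun σ τ => Disjoint (e σ).chart.source (e τ).chart.source)
    (hk : ∀ σ, IsProfile (k σ)) (hα : ∀ σ, 0 < α σ)
    (hdisc : ∀ σ, {z : ℂ | ‖z ^ (e σ).n‖ ≤ α σ} ⊆ (e σ).chart.target)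
    (hβ : ∀ σ, β σ ≤ 0) (hlβ : ∀ σ, 0 < l + β σ) {x : S} (hx : x ∉ η.zeros) (i : ℕ) :
    stableTerm η l (pertMap η e l φ k α β) x i =
      seriesTerm l (pertMap η e l φ k α β) (contA e l k α β) (contB e k α β) i x := by
  have hspec := fun {x : S} (hx : x ∉ η.zeros) =>
    pertMap_spec hφ hdisj hk hα hdisc hβ hlβ hx
  have hit : ∀ j, (pertMap η e l φ k α β)^[j] x ∉ η.zeros := by
    intro j
    induction j with
    | zero => exact hx
    | succ j ih =>
      rw [Function.iterate_succ_apply']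
      exact (hspec ih).1
  rw [stableTerm, seriesTerm, (hspec (hit i)).2.2.2]
  congr 1
  exact Finset.prod_congr rfl fun j _ => by rw [(hspec (hit j)).2.2.1]

theorem contA_pos (hdisj : Pairwise fun σ τ => Disjoint (e σ).chart.source (e τ).chart.source)
    (hk : ∀ σ, IsProfile (k σ)) (hα : ∀ σ, 0 < α σ) (hl : 0 < l)
    (hβ : ∀ σ, β σ ≤ 0) (hlβ : ∀ σ, 0 < l + β σ) (x : S) : 0 < contA e l k α β x := by
  by_cases h : ∃ σ : η.zeros, x ∈ (e σ).chart.source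
  · obtain ⟨σ, hσ⟩ := h
    rw [contA, glue_of_mem hdisj _ _ hσ]
    exact (hlβ σ).trans_le ((add_le_gain (hα σ) (hβ σ) (hk σ) _).trans
      (le_modelA (hα σ) (hβ σ) (hk σ) _))
  · rw [contA, glue, dif_neg h]; exact hl

/-- Geometric decay of the terms of the series, uniform in the point and in the parameters. -/
theorem abs_seriesTerm_pertMap_le [T2Space S] {φ : S ≃ₜ S} (hφ : IsLinearPseudoAnosov η l φ)
    (hdisj : Pairwise fun σ τ => Disjoint (e σ).chart.source (e τ).chart.source)
    (hsheet : RespectsSheets η e l φ)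
    (hk : ∀ σ, IsProfile (k σ)) (hα : ∀ σ, 0 < α σ)
    (hdisc : ∀ σ, {z : ℂ | ‖z ^ (e σ).n‖ ≤ α σ} ⊆ (e σ).chart.target)
    {C a₀ : ℝ} (hC : 0 ≤ C) (hkC : ∀ σ t, |deriv (k σ) t| ≤ C * |t|)
    (ha₀ : (l ^ 2)⁻¹ < a₀) (hβ : ∀ σ, β σ ≤ 0) (hlβ : ∀ σ, a₀ ≤ l + β σ) (i : ℕ) (x : S) :
    |seriesTerm l (pertMap η e l φ k α β) (contA e l k α β) (contB e k α β) i x| ≤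
      l * C / a₀ * max l⁻¹ ((l ^ 2)⁻¹ / a₀) ^ i := by
  have hl : 0 < l := one_pos.trans hφ.1
  have ha : 0 < a₀ := lt_trans (by positivity) ha₀
  have hlβ' : ∀ σ, 0 < l + β σ := fun σ => ha.trans_le (hlβ σ)
  refine abs_seriesTerm_le hφ.1 ha₀ (by positivity) (fun x r w => ∃ σ : η.zeros,
    x ∈ (e σ).disc (α σ) ∧ r = α σ ∧ w = (e σ).chart x ^ (e σ).n) ?_ ?_ i x
  · intro x
    by_cases h : ∀ σ, x ∉ (e σ).disc (α σ)
    · exact Or.inl ⟨contA_of_notMem hk hα h, contB_of_notMem hk hα h⟩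
    · push Not at h
      obtain ⟨σ, hσ⟩ := h
      exact Or.inr ⟨_, _, σ, hσ, rfl, rfl⟩
  rintro x _ _ ⟨σ, ⟨hxs, hxα⟩, rfl, rfl⟩
  set c := e σ with hc
  set ξ := c.chart x ^ c.n with hξ
  refine ⟨hα σ, hxα, ?_, l + β σ * k σ (‖ξ‖ / α σ),
    (hlβ σ).trans (add_le_gain (hα σ) (hβ σ) (hk σ) ξ), ?_, ?_⟩
  · rw [contB, glue_of_mem hdisj _ _ hxs]
    refine abs_modelB_le (hα σ) ?_ hC (hkC σ) hxα
    rw [abs_of_nonpos (hβ σ)]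
    linarith [hlβ' σ]
  · rw [contA, glue_of_mem hdisj _ _ hxs]
    exact le_modelA (hα σ) (hβ σ) (hk σ) _
  · change α σ < ‖modelMap l (β σ) (α σ) (k σ) ξ‖ ∨ ∃ τ : η.zeros,
      pertMap η e l φ k α β x ∈ (e τ).disc (α τ) ∧ α σ = α τ ∧
        modelMap l (β σ) (α σ) (k σ) ξ = (e τ).chart (pertMap η e l φ k α β x) ^ (e τ).n
    rcases lt_or_ge (α σ) ‖modelMap l (β σ) (α σ) (k σ) ξ‖ with h | h
    · exact Or.inl h
    right
    set z := sheetLift c.n (discMap l (β σ) (α σ) (k σ)) (c.chart x) with hz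
    have hzn : z ^ c.n = discMap l (β σ) (α σ) (k σ) ξ :=
      sheetLift_pow_of_zero c.n_pos (discMap_zero l (β σ) (α σ) (k σ)) _
    have hzd : diagMap l (z ^ c.n) = modelMap l (β σ) (α σ) (k σ) ξ := by
      rw [hzn, diagMap_discMap hl.ne']
    have hzα : ‖z ^ c.n‖ ≤ α σ := by
      rw [hzn]
      exact (norm_discMap_le hl (hα σ) (hβ σ) (hlβ' σ) (hk σ) _).trans hxα
    have hz' : ‖diagMap l (z ^ c.n)‖ ≤ α σ := hzd ▸ h
    -- Both the point moved by the disc map and its expected image under `diagMap l` lie in the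
    -- disc, so `φ` acts there as the lift and the orbit can be followed in `ξ`.
    have h1 := c.apply_symm_eq σ.2 hl φ.continuous hφ.2.2 (hsheet σ).1 (hsheet σ).2 (hdisc σ)
      hzα hz'
    set w := sheetLift c.n (diagMap l) z with hw
    have hwn : w ^ c.n = modelMap l (β σ) (α σ) (k σ) ξ := by
      rw [← hzd]
      exact sheetLift_pow_of_zero c.n_pos (by apply Complex.ext <;> simp [diagMap]) _
    have hwt : w ∈ c.chart.target := hdisc σ (show ‖w ^ c.n‖ ≤ α σ from hwn ▸ h)
    have h2 : pertMap η e l φ k α β x = c.chart.symm w :=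
      (pertMap_of_mem hdisj hk hα hl.ne' φ hxs).trans h1
    have h3 : c.chart (c.chart.symm w) = w := c.chart.right_inv hwt
    refine ⟨σ, ?_, rfl, ?_⟩
    · rw [h2]
      refine ⟨c.chart.map_target hwt, ?_⟩
      rw [h3, hwn]
      exact h
    · rw [h2, h3, hwn]

end

/-! ### Continuity in the point and the parameter -/

section

variable {S : Type*} [TopologicalSpace S] [ChartedSpace ℂ S] {η : AbelianDifferential S}
variable {e : ∀ σ : η.zeros, ConeChart η σ.1} {l : ℝ} {k : η.zeros → ℝ → ℝ} {α : η.zeros → ℝ}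

theorem paramRange_le {β : η.zeros → ℝ} (hβ : β ∈ paramRange η l) (σ : η.zeros) : β σ ≤ 0 :=
  (hβ σ).2

theorem paramRange_pos (hl : 1 < l) {β : η.zeros → ℝ} (hβ : β ∈ paramRange η l) (σ : η.zeros) :
    0 < l + β σ := by
  have h1 : 0 < (l ^ 2)⁻¹ := by positivity
  linarith [(hβ σ).1]

/-- Near every admissible parameter, the stretch factors at the conical points are bounded below by
a constant larger than `l⁻²`. -/
theorem exists_lower_bound [Finite η.zeros] {β₀ : η.zeros → ℝ}
    (hβ₀ : β₀ ∈ paramRange η l) :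
    ∃ a₀, (l ^ 2)⁻¹ < a₀ ∧ ∃ U : Set (η.zeros → ℝ), IsOpen U ∧ β₀ ∈ U ∧
      ∀ β ∈ U, ∀ σ, a₀ ≤ l + β σ := by
  have h1 : ∀ σ, ∃ a, (l ^ 2)⁻¹ < a ∧ a < l + β₀ σ := fun σ =>
    exists_between (by linarith [(hβ₀ σ).1])
  choose a ha ha' using h1
  obtain ⟨a₀, ha₀, ha₀'⟩ : ∃ a₀, (l ^ 2)⁻¹ < a₀ ∧ ∀ σ, a₀ ≤ a σ := by
    rcases isEmpty_or_nonempty η.zeros with h | h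
    -- Without conical points the bound on the gains is vacuous, and any constant above `l⁻²`
    -- serves.
    · exact ⟨_, lt_add_one _, fun σ => h.elim σ⟩
    · obtain ⟨σ, hσ⟩ := Finite.exists_min a
      exact ⟨a σ, ha σ, hσ⟩
  refine ⟨a₀, ha₀, univ.pi fun σ => Ioi (a σ - l), isOpen_set_pi finite_univ fun _ _ => isOpen_Ioi,
    fun σ _ => ?_, fun β hβ σ => ?_⟩
  · have := ha' σ
    simp only [mem_Ioi]
    linarith
  · have := hβ σ (mem_univ _)
    simp only [mem_Ioi] at this
    linarith [ha₀' σ]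

theorem continuous_param {X : Type*} [TopologicalSpace X] (σ : η.zeros) :
    Continuous fun p : paramRange η l × X => p.1.1 σ :=
  (continuous_apply σ).comp (continuous_subtype_val.comp continuous_fst)

theorem continuousOn_param_chart_pow (σ : η.zeros) :
    ContinuousOn (fun p : paramRange η l × S => (p.1.1 σ, (e σ).chart p.2 ^ (e σ).n))
      {p | p.2 ∈ (e σ).chart.source} :=
  (continuous_param σ).continuousOn.prodMk
    (((e σ).chart.continuousOn.comp continuousOn_snd fun _ hp => hp).pow _)

theorem exists_deriv_bound [Finite η.zeros] (hk : ∀ σ, IsProfile (k σ)) :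
    ∃ C : ℝ, 0 ≤ C ∧ ∀ σ t, |deriv (k σ) t| ≤ C * |t| := by
  choose C hC hkC using fun σ => (hk σ).exists_abs_deriv_le
  obtain ⟨M, hM⟩ := (finite_range C).bddAbove
  refine ⟨max M 0, le_max_right _ _, fun σ t => (hkC σ t).trans ?_⟩
  gcongr
  exact (hM ⟨σ, rfl⟩).trans (le_max_left _ _)

variable [T2Space S] [Finite η.zeros]

theorem continuous_pertMap {φ : S ≃ₜ S} (hl : 1 < l)
    (hdisj : Pairwise fun σ τ => Disjoint (e σ).chart.source (e τ).chart.source)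
    (hk : ∀ σ, IsProfile (k σ)) (hα : ∀ σ, 0 < α σ)
    (hdisc : ∀ σ, {z : ℂ | ‖z ^ (e σ).n‖ ≤ α σ} ⊆ (e σ).chart.target) :
    Continuous fun p : paramRange η l × S => pertMap η e l φ k α p.1.1 p.2 := by
  have hl0 : 0 < l := one_pos.trans hl
  refine continuous_of_discs hdisc (g := fun σ p => φ ((e σ).chart.symm
    (sheetLift (e σ).n (discMap l (p.1.1 σ) (α σ) (k σ)) ((e σ).chart p.2)))) (fun σ => ?_)
    (φ.continuous.comp continuous_snd) (fun σ p hp => pertMap_of_mem hdisj hk hα hl0.ne' φ hp)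
    fun p hp => pertMap_of_notMem φ hp
  have hL : Continuous fun p : paramRange η l × ℂ =>
      sheetLift (e σ).n (discMap l (p.1.1 σ) (α σ) (k σ)) p.2 := by
    refine continuous_sheetLift (e σ).n_pos
      (T := fun β : paramRange η l => discMap l (β.1 σ) (α σ) (k σ)) ?_ ?_ ?_
    · have h1 : Continuous fun p : paramRange η l × ℂ => (p.1.1 σ, p.2) :=
        (continuous_param σ).prodMk continuous_snd
      exact (continuous_discMap l (α σ) (hk σ)).comp h1
    · exact fun β w hw => discMap_div_re_pos hl0 hw
        ((paramRange_pos hl β.2 σ).trans_le (add_le_gain (hα σ) (paramRange_le β.2 σ) (hk σ) w))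
    · exact fun β w => norm_discMap_le hl0 (hα σ) (paramRange_le β.2 σ)
        (paramRange_pos hl β.2 σ) (hk σ) w
  have hchart : ContinuousOn (fun p : paramRange η l × S => (p.1, (e σ).chart p.2))
      {p | p.2 ∈ (e σ).chart.source} :=
    continuousOn_fst.prodMk ((e σ).chart.continuousOn.comp continuousOn_snd fun p hp => hp)
  refine φ.continuous.comp_continuousOn ((e σ).chart.continuousOn_symm.comp
    (hL.comp_continuousOn hchart) fun p hp => ?_)
  -- The lift must land in the chart's target: on the disc it does not increase the norm, and beyond
  -- the disc it is the identity.
  by_cases h : ‖(e σ).chart p.2 ^ (e σ).n‖ ≤ α σ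
  · apply hdisc σ
    change ‖sheetLift _ _ _ ^ (e σ).n‖ ≤ α σ
    rw [sheetLift_pow_of_zero (e σ).n_pos (discMap_zero _ _ _ _)]
    exact (norm_discMap_le hl0 (hα σ) (paramRange_le p.1.2 σ) (paramRange_pos hl p.1.2 σ)
      (hk σ) _).trans h
  · rw [sheetLift_of_eq (discMap_of_le hl0.ne' (hα σ) (hk σ) (not_le.1 h).le)]
    exact (e σ).chart.map_source hp

theorem continuous_contA
    (hdisj : Pairwise fun σ τ => Disjoint (e σ).chart.source (e τ).chart.source)
    (hk : ∀ σ, IsProfile (k σ)) (hα : ∀ σ, 0 < α σ)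
    (hdisc : ∀ σ, {z : ℂ | ‖z ^ (e σ).n‖ ≤ α σ} ⊆ (e σ).chart.target) :
    Continuous fun p : paramRange η l × S => contA e l k α p.1.1 p.2 :=
  continuous_of_discs hdisc (fun σ => (continuous_modelA l (hα σ) (hk σ)).comp_continuousOn
    (continuousOn_param_chart_pow σ)) continuous_const (fun _ _ hp => glue_of_mem hdisj _ _ hp)
    fun _ hp => contA_of_notMem hk hα hp

theorem continuous_contB
    (hdisj : Pairwise fun σ τ => Disjoint (e σ).chart.source (e τ).chart.source)
    (hk : ∀ σ, IsProfile (k σ)) (hα : ∀ σ, 0 < α σ)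
    (hdisc : ∀ σ, {z : ℂ | ‖z ^ (e σ).n‖ ≤ α σ} ⊆ (e σ).chart.target) :
    Continuous fun p : paramRange η l × S => contB e k α p.1.1 p.2 :=
  continuous_of_discs hdisc (fun σ => (continuous_modelB (hα σ) (hk σ)).comp_continuousOn
    (continuousOn_param_chart_pow σ)) continuous_const (fun _ _ hp => glue_of_mem hdisj _ _ hp)
    fun _ hp => contB_of_notMem hk hα hp

/-- Joint continuity of the terms of the series in the point and in a parameter. -/
theorem continuous_seriesTerm {P X : Type*} [TopologicalSpace P] [TopologicalSpace X] (l : ℝ)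
    {f : P → X → X} {A B : P → X → ℝ} (hf : Continuous fun p : P × X => f p.1 p.2)
    (hA : Continuous fun p : P × X => A p.1 p.2) (hB : Continuous fun p : P × X => B p.1 p.2)
    (hA0 : ∀ b x, A b x ≠ 0) (i : ℕ) :
    Continuous fun p : P × X => seriesTerm l (f p.1) (A p.1) (B p.1) i p.2 := by
  have hit : ∀ j, Continuous fun p : P × X => (p.1, (f p.1)^[j] p.2) := by
    intro j
    induction j with
    | zero => exact continuous_id
    | succ j ih =>
      simp only [Function.iterate_succ_apply']
      exact continuous_fst.prodMk (hf.comp ih)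
  exact (continuous_const.mul (hB.comp (hit i))).mul
    (continuous_finsetProd _ fun j _ => (hA.comp (hit j)).inv₀ fun p => hA0 _ _)

/-- The sum of the series is jointly continuous, at the conical points included. -/
theorem continuous_tsum_seriesTerm {φ : S ≃ₜ S} (hφ : IsLinearPseudoAnosov η l φ)
    (hdisj : Pairwise fun σ τ => Disjoint (e σ).chart.source (e τ).chart.source)
    (hsheet : RespectsSheets η e l φ) (hk : ∀ σ, IsProfile (k σ)) (hα : ∀ σ, 0 < α σ)
    (hdisc : ∀ σ, {z : ℂ | ‖z ^ (e σ).n‖ ≤ α σ} ⊆ (e σ).chart.target) :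
    (∀ (β : paramRange η l) (x : S), Summable fun i => seriesTerm l (pertMap η e l φ k α β.1)
      (contA e l k α β.1) (contB e k α β.1) i x) ∧
    Continuous fun p : paramRange η l × S => ∑' i, seriesTerm l (pertMap η e l φ k α p.1.1)
      (contA e l k α p.1.1) (contB e k α p.1.1) i p.2 := by
  have hl := hφ.1
  have hl0 : 0 < l := one_pos.trans hl
  obtain ⟨C, hC, hkC⟩ := exists_deriv_bound hk
  have hgeom : ∀ a₀, (l ^ 2)⁻¹ < a₀ →
      Summable fun i : ℕ => l * C / a₀ * max l⁻¹ ((l ^ 2)⁻¹ / a₀) ^ i := by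
    intro a₀ ha₀
    have ha : 0 < a₀ := lt_trans (by positivity) ha₀
    refine (summable_geometric_of_lt_one (le_max_of_le_left (by positivity)) ?_).mul_left _
    -- The lower end `-l + l⁻²` of the parameter range is what makes this ratio less than `1`.
    exact max_lt (inv_lt_one_of_one_lt₀ hl) ((div_lt_one ha).2 ha₀)
  have hbound : ∀ (β : paramRange η l) (a₀ : ℝ), (l ^ 2)⁻¹ < a₀ → (∀ σ, a₀ ≤ l + β.1 σ) →
      ∀ i x, ‖seriesTerm l (pertMap η e l φ k α β.1) (contA e l k α β.1) (contB e k α β.1) i x‖ ≤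
        l * C / a₀ * max l⁻¹ ((l ^ 2)⁻¹ / a₀) ^ i := fun β a₀ ha₀ hβ i x =>
    abs_seriesTerm_pertMap_le hφ hdisj hsheet hk hα hdisc hC hkC ha₀ (paramRange_le β.2) hβ i x
  refine ⟨fun β x => ?_, continuous_iff_continuousAt.2 fun p => ?_⟩
  · obtain ⟨a₀, ha₀, U, -, hβU, hU⟩ := exists_lower_bound β.2
    exact (hgeom a₀ ha₀).of_norm_bounded fun i => hbound β a₀ ha₀ (hU _ hβU) i x
  · obtain ⟨a₀, ha₀, U, hUo, hβU, hU⟩ := exists_lower_bound p.1.2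
    have hterm := continuous_seriesTerm (P := paramRange η l)
      (f := fun β => pertMap η e l φ k α β.1) (A := fun β => contA e l k α β.1)
      (B := fun β => contB e k α β.1) l (continuous_pertMap (φ := φ) hl hdisj hk hα hdisc)
      (continuous_contA hdisj hk hα hdisc) (continuous_contB hdisj hk hα hdisc)
      fun β x => (contA_pos hdisj hk hα hl0 (paramRange_le β.2) (paramRange_pos hl β.2) x).ne'
    have hUo' : IsOpen {q : paramRange η l × S | q.1.1 ∈ U} := hUo.preimage (by fun_prop)
    exact (continuousOn_tsum (s := {q : paramRange η l × S | q.1.1 ∈ U})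
      (fun i => (hterm i).continuousOn) (hgeom a₀ ha₀)
      fun i q hq => hbound q.1 a₀ ha₀ (hU _ hq) i q.2).continuousAt (hUo'.mem_nhds hβU)

end

end PertPA

end

/-! ### The main theorem -/

theorem mainTheorem9 {S : Type*} [TopologicalSpace S] [T2Space S] [CompactSpace S]
    [ConnectedSpace S] [ChartedSpace ℂ S] [IsManifold 𝓘(ℂ) ω S]
    (η : PertPA.AbelianDifferential S) (l : ℝ) (φ : S ≃ₜ S)
    (hφ : PertPA.IsLinearPseudoAnosov η l φ)
    (e : ∀ σ : η.zeros, PertPA.ConeChart η σ.1)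
    (hdisj : Pairwise fun σ τ => Disjoint (e σ).chart.source (e τ).chart.source)
    (hsheet : PertPA.RespectsSheets η e l φ)
    (k : η.zeros → ℝ → ℝ) (hk : ∀ σ, PertPA.IsProfile (k σ))
    (α : η.zeros → ℝ) (hα : ∀ σ, 0 < α σ)
    (hdisc : ∀ σ, {z : ℂ | ‖z ^ (e σ).n‖ ≤ α σ} ⊆ (e σ).chart.target) :
    -- the field is well defined outside the conical points
    (∀ β ∈ PertPA.paramRange η l, ∀ x ∉ η.zeros,
      PertPA.pertMap η e l φ k α β x ∉ η.zeros ∧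
      MDifferentiableAt 𝓘(ℝ, ℂ) 𝓘(ℝ, ℂ) (PertPA.pertMap η e l φ k α β) x ∧
      0 < PertPA.coefA η (PertPA.pertMap η e l φ k α β) x ∧
      Summable (PertPA.stableTerm η l (PertPA.pertMap η e l φ k α β) x)) ∧
    -- it is bounded and continuous, and depends continuously on `β` for the sup norm
    (∃ V : PertPA.paramRange η l → ({x : S // x ∉ η.zeros} →ᵇ ℂ),
      (∀ β x, V β x =
        η.coord x.1 (PertPA.stableField η l (PertPA.pertMap η e l φ k α β.1) x.1)) ∧
      Continuous V) ∧
    -- it is jointly continuous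
    Continuous (fun p : {x : S // x ∉ η.zeros} × PertPA.paramRange η l =>
      η.coord p.1.1 (PertPA.stableField η l (PertPA.pertMap η e l φ k α p.2.1) p.1.1)) := by
  have : Finite η.zeros := PertPA.finite_zeros e
  have hl : 1 < l := hφ.1
  obtain ⟨hsum, hcont⟩ := PertPA.continuous_tsum_seriesTerm hφ hdisj hsheet hk hα hdisc
  have hterm : ∀ (β : PertPA.paramRange η l) {x : S}, x ∉ η.zeros →
      PertPA.stableTerm η l (PertPA.pertMap η e l φ k α β.1) x = fun i =>
        PertPA.seriesTerm l (PertPA.pertMap η e l φ k α β.1) (PertPA.contA e l k α β.1)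
          (PertPA.contB e k α β.1) i x := fun β x hx => funext fun i =>
    PertPA.stableTerm_eq hφ hdisj hk hα hdisc (PertPA.paramRange_le β.2)
      (PertPA.paramRange_pos hl β.2) hx i
  -- Joint continuity curries to a continuous map into `C(S, ℝ)`, whose compact-open topology is
  -- that of the sup norm as `S` is compact. The extension to the conical points is needed here,
  -- since their complement need not be compact.
  let F : PertPA.paramRange η l → C(S, ℝ) := ContinuousMap.curry ⟨_, hcont⟩
  let G : C(S, ℂ) → ({x : S // x ∉ η.zeros} →ᵇ ℂ) := fun g =>
    (BoundedContinuousFunction.mkOfCompact g).compContinuous ⟨Subtype.val, continuous_subtype_val⟩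
  have hG : Continuous G := by
    refine (BoundedContinuousFunction.continuous_compContinuous _).comp ?_
    exact (ContinuousMap.isometryEquivBoundedOfCompact S ℂ).continuous
  let H : C(S, ℝ) → C(S, ℂ) := fun g =>
    ⟨fun x => Complex.I - g x, by fun_prop⟩
  have hH : Continuous H :=
    ContinuousMap.continuous_postcomp ⟨fun t : ℝ => Complex.I - (t : ℂ), by fun_prop⟩
  have hF : Continuous F := (ContinuousMap.curry ⟨_, hcont⟩).continuous
  have hcoord : ∀ (β : PertPA.paramRange η l) (x : {x : S // x ∉ η.zeros}),
      η.coord x.1 (PertPA.stableField η l (PertPA.pertMap η e l φ k α β.1) x.1) =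
        Complex.I - (F β x.1 : ℝ) := by
    intro β x
    rw [PertPA.stableField, PertPA.coord_vec_eq η x.2, hterm β x.2]
    rfl
  refine ⟨fun β hβ x hx => ?_, ⟨fun β => G (H (F β)), fun β x => ?_, hG.comp (hH.comp hF)⟩, ?_⟩
  · obtain ⟨h1, h2, h3, -⟩ := PertPA.pertMap_spec hφ hdisj hk hα hdisc (PertPA.paramRange_le hβ)
      (PertPA.paramRange_pos hl hβ) hx
    refine ⟨h1, h2, h3 ▸ PertPA.contA_pos hdisj hk hα (one_pos.trans hl) (PertPA.paramRange_le hβ)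
      (PertPA.paramRange_pos hl hβ) x, ?_⟩
    rw [hterm ⟨β, hβ⟩ hx]
    exact hsum ⟨β, hβ⟩ x
  · exact (hcoord β x).symm
  · simp only [fun p : {x : S // x ∉ η.zeros} × PertPA.paramRange η l => hcoord p.2 p.1]
    have h1 : Continuous fun p : {x : S // x ∉ η.zeros} × PertPA.paramRange η l =>
        (p.2, p.1.1) := by fun_prop
    have h2 := hcont.comp h1
    exact continuous_const.sub (Complex.continuous_ofReal.comp h2)
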